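/- Let $X$ be a compact Kähler manifold, that is, a compact (Hausdorff) complex manifold, modelled on a finite-dimensional complex vector space, whose real tangent bundle $TX$ carries a smooth Riemannian metric $\langle\cdot,\cdot\rangle$ such that $\langle Ju,Jv\rangle=\langle u,v\rangle$ for the complex structure $J$ of $X$ and such that the fundamental form $\omega(u,v)=\langle Ju,v\rangle$ is closed, $d\omega=0$. Let $\nabla$ be the Levi-Civita connection of the metric and let $U,V$ be two smooth real vector fields on $X$. Let $$R(U,V)=\nabla_U\nabla_V-\nabla_V\nabla_U-\nabla_{[U,V]}$$ be the curvature operator on smooth vector fields; it is given by an endomorphism of each tangent space $T_xX$, and $\exp(R(U,V))$ denotes the fibrewise exponential of this endomorphism. A vector bundle automorphism of $TX$ is a ($C^\infty$) diffeomorphism $TX\to TX$ that maps every fibre $T_xX$ linearly to itself. It is called symplectic if it preserves $\omega$, and unipotent if for every $x\in X$ its restriction $S_x$ to $T_xX$ satisfies $(S_x-\mathrm{id})^m=0$ for some $m$. Then $\exp(R(U,V))$ is a symplectic vector bundle automorphism of $TX$, and there are finitely many unipotent symplectic vector bundle automorphisms $E_1,\dots,E_N$ of $TX$ such that $$\exp(R(U,V))=E_N\circ\cdots\circ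 E_1 .$$ -/

import Mathlib

open Bundle Manifold
open scoped ContDiff

namespace RiemannianGeometry
noncomputable section

variable {E : Type*} [NormedAddCommGroup E] [NormedSpace ℝ E]
  {H : Type*} [TopologicalSpace H] {I : ModelWithCorners ℝ E H}
  {M : Type*} [TopologicalSpace M] [ChartedSpace H M]
  [RiemannianBundle (fun x : M ↦ TangentSpace I x)]

/-- The right-hand side of the Koszul formula
`2⟨∇_X Y, Z⟩ = X⟨Y, Z⟩ + Y⟨X, Z⟩ - Z⟨X, Y⟩ + ⟨[X, Y], Z⟩ - ⟨[X, Z], Y⟩ - ⟨[Y, Z], X⟩`. -/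
def koszul (X Y Z : ∀ x : M, TangentSpace I x) (x : M) : ℝ :=
  mvfderiv I (fun y ↦ inner ℝ (Y y) (Z y)) x (X x)
    + mvfderiv I (fun y ↦ inner ℝ (X y) (Z y)) x (Y x)
    - mvfderiv I (fun y ↦ inner ℝ (X y) (Y y)) x (Z x)
    + inner ℝ (VectorField.mlieBracket I X Y x) (Z x)
    - inner ℝ (VectorField.mlieBracket I X Z x) (Y x)
    - inner ℝ (VectorField.mlieBracket I Y Z x) (X x)

theorem inner_fun_comm (Y Z : ∀ x : M, TangentSpace I x) :
    (fun y ↦ inner ℝ (Y y) (Z y)) = fun y ↦ inner ℝ (Z y) (Y y) :=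
  funext fun _ ↦ real_inner_comm _ _

theorem eq_of_inner_eq [IsManifold I ∞ M] {x : M} {A B : TangentSpace I x →L[ℝ] TangentSpace I x}
    (h : ∀ X Z : ∀ x : M, TangentSpace I x, MDiffAt (T% X) x → MDiffAt (T% Z) x →
      2 * inner ℝ (A (X x)) (Z x) = 2 * inner ℝ (B (X x)) (Z x)) : A = B := by
  ext v
  refine ext_inner_right ℝ fun w ↦ ?_
  have := h (FiberBundle.extend E v) (FiberBundle.extend E w)
    (FiberBundle.mdifferentiableAt_extend ..) (FiberBundle.mdifferentiableAt_extend ..)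
  simpa using this

variable [IsManifold I ∞ M]
  [IsContMDiffRiemannianBundle I ∞ E (fun x : M ↦ TangentSpace I x)]
  {X Y Z Z' : ∀ x : M, TangentSpace I x} {f : M → ℝ} {x : M}

theorem mdifferentiableAt_inner (hY : MDiffAt (T% Y) x) (hZ : MDiffAt (T% Z) x) :
    MDiffAt (fun y ↦ inner ℝ (Y y) (Z y)) x :=
  MDifferentiableAt.inner_bundle (IB := I) (F := E) (E := fun x : M ↦ TangentSpace I x)
    (b := fun y ↦ y) hY hZ

theorem mvfderiv_inner_smul_right (hf : MDiffAt f x) (hY : MDiffAt (T% Y) x)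
    (hZ : MDiffAt (T% Z) x) (v : TangentSpace I x) :
    mvfderiv I (fun y ↦ inner ℝ (Y y) ((f • Z) y)) x v =
      f x * mvfderiv I (fun y ↦ inner ℝ (Y y) (Z y)) x v
        + inner ℝ (Y x) (Z x) * mvfderiv I f x v := by
  have h := mvfderiv_mul hf (mdifferentiableAt_inner hY hZ)
  have e : (fun y ↦ inner ℝ (Y y) ((f • Z) y)) = f * fun y ↦ inner ℝ (Y y) (Z y) := by
    funext y
    simp [inner_smul_right]
  rw [e, h]
  simp

theorem mvfderiv_inner_add_right (hY : MDiffAt (T% Y) x)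
    (hZ : MDiffAt (T% Z) x) (hZ' : MDiffAt (T% Z') x) (v : TangentSpace I x) :
    mvfderiv I (fun y ↦ inner ℝ (Y y) ((Z + Z') y)) x v =
      mvfderiv I (fun y ↦ inner ℝ (Y y) (Z y)) x v
        + mvfderiv I (fun y ↦ inner ℝ (Y y) (Z' y)) x v := by
  have h := mvfderiv_add (mdifferentiableAt_inner hY hZ) (mdifferentiableAt_inner hY hZ')
  have e : (fun y ↦ inner ℝ (Y y) ((Z + Z') y)) =
      (fun y ↦ inner ℝ (Y y) (Z y)) + fun y ↦ inner ℝ (Y y) (Z' y) := by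
    funext y
    simp [inner_add_right]
  rw [e, h]
  simp

variable [FiniteDimensional ℝ E]

theorem koszul_tensorial_right
    (hX : MDiffAt (T% X) x) (hY : MDiffAt (T% Y) x) :
    TensorialAt I E (fun Z ↦ koszul X Y Z x) x := by
  have := FiniteDimensional.complete ℝ E
  constructor
  · intro f Z hf hZ
    simp only [koszul, mvfderiv_inner_smul_right hf hX hZ, mvfderiv_inner_smul_right hf hY hZ,
      VectorField.mlieBracket_smul_right hf hZ]
    simp only [inner_add_left, real_inner_smul_left,
      Pi.smul_apply', map_smul, real_inner_smul_right, smul_eq_mul]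
    rw [real_inner_comm (Y x) (Z x), real_inner_comm (X x) (Z x)]
    ring
  · intro Z Z' hZ hZ'
    simp only [koszul, mvfderiv_inner_add_right hX hZ hZ', mvfderiv_inner_add_right hY hZ hZ',
      VectorField.mlieBracket_add_right hZ hZ']
    simp only [inner_add_left, inner_add_right, Pi.add_apply, map_add]
    ring

theorem koszul_tensorial_left
    (hY : MDiffAt (T% Y) x) (hZ : MDiffAt (T% Z) x) :
    TensorialAt I E (fun X ↦ koszul X Y Z x) x := by
  have := FiniteDimensional.complete ℝ E
  constructor
  · intro f X hf hX
    simp only [koszul, inner_fun_comm (f • X), mvfderiv_inner_smul_right hf hZ hX,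
      mvfderiv_inner_smul_right hf hY hX, VectorField.mlieBracket_smul_left hf hX,
      inner_fun_comm X]
    simp only [inner_add_left, real_inner_smul_left, Pi.smul_apply', map_smul,
      real_inner_smul_right, smul_eq_mul, inner_neg_left, neg_smul]
    rw [real_inner_comm (Y x) (X x), real_inner_comm (Z x) (X x)]
    ring
  · intro X X' hX hX'
    simp only [koszul, inner_fun_comm (X + X'), mvfderiv_inner_add_right hZ hX hX',
      mvfderiv_inner_add_right hY hX hX', inner_fun_comm X, inner_fun_comm X',
      VectorField.mlieBracket_add_left hX hX']
    simp only [inner_add_left, inner_add_right, Pi.add_apply, map_add]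
    ring

theorem exists_koszul (hY : MDiffAt (T% Y) x) :
    ∃ A : TangentSpace I x →L[ℝ] TangentSpace I x, ∀ X Z : ∀ x : M, TangentSpace I x, 
      MDiffAt (T% X) x → MDiffAt (T% Z) x → 2 * inner ℝ (A (X x)) (Z x) = koszul X Y Z x := by
  have : FiniteDimensional ℝ (TangentSpace I x) := inferInstanceAs (FiniteDimensional ℝ E)
  have : CompleteSpace (TangentSpace I x) := FiniteDimensional.complete ℝ _
  let L := TensorialAt.mkHom₂ (fun X Z ↦ koszul X Y Z x) x
    (fun Z hZ ↦ koszul_tensorial_left hY hZ) (fun X hX ↦ koszul_tensorial_right hX hY)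
  let A : TangentSpace I x →ₗ[ℝ] TangentSpace I x :=
    { toFun := fun v ↦ (1 / 2 : ℝ) • (InnerProductSpace.toDual ℝ _).symm (L v)
      map_add' := fun v w ↦ by rw [map_add, map_add, smul_add]
      map_smul' := fun c v ↦ by
        rw [map_smul, map_smulₛₗ, RingHom.id_apply, smul_comm]
        rfl }
  refine ⟨LinearMap.toContinuousLinearMap A, fun X Z hX hZ ↦ ?_⟩
  have h := TensorialAt.mkHom₂_apply (Φ := fun X Z ↦ koszul X Y Z x)
    (fun Z hZ ↦ koszul_tensorial_left hY hZ) (fun X hX ↦ koszul_tensorial_right hX hY) hX hZ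
  rw [← h]
  simp [A, real_inner_smul_left, L]

theorem koszul_add_mid {Y' : ∀ x : M, TangentSpace I x} (hX : MDiffAt (T% X) x)
    (hY : MDiffAt (T% Y) x) (hY' : MDiffAt (T% Y') x) (hZ : MDiffAt (T% Z) x) :
    koszul X (Y + Y') Z x = koszul X Y Z x + koszul X Y' Z x := by
  have := FiniteDimensional.complete ℝ E
  simp only [koszul, inner_fun_comm (Y + Y'), mvfderiv_inner_add_right hZ hY hY',
    mvfderiv_inner_add_right hX hY hY', inner_fun_comm Y, inner_fun_comm Y',
    VectorField.mlieBracket_add_left hY hY', VectorField.mlieBracket_add_right hY hY']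
  simp only [inner_add_left, inner_add_right, Pi.add_apply, map_add]
  ring

theorem koszul_smul_mid (hf : MDiffAt f x) (hX : MDiffAt (T% X) x)
    (hY : MDiffAt (T% Y) x) (hZ : MDiffAt (T% Z) x) :
    koszul X (f • Y) Z x =
      f x * koszul X Y Z x + 2 * (mvfderiv I f x (X x) * inner ℝ (Y x) (Z x)) := by
  have := FiniteDimensional.complete ℝ E
  simp only [koszul, inner_fun_comm (f • Y), mvfderiv_inner_smul_right hf hZ hY,
    mvfderiv_inner_smul_right hf hX hY, inner_fun_comm Y,
    VectorField.mlieBracket_smul_left hf hY, VectorField.mlieBracket_smul_right hf hY]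
  simp only [inner_add_left, real_inner_smul_left, Pi.smul_apply', map_smul,
    real_inner_smul_right, smul_eq_mul, inner_neg_left, neg_smul]
  rw [real_inner_comm (Y x) (X x), real_inner_comm (Z x) (Y x)]
  ring

open Classical in
/-- The value at `x` of the Levi-Civita derivative of the field `Y`, as a function of the
direction of differentiation. -/
def leviCivitaAt (Y : ∀ x : M, TangentSpace I x) (x : M) :
    TangentSpace I x →L[ℝ] TangentSpace I x :=
  if hY : MDiffAt (T% Y) x then (exists_koszul hY).choose else 0

/-- The Koszul formula. -/
theorem inner_leviCivitaAt (hX : MDiffAt (T% X) x) (hY : MDiffAt (T% Y) x)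
    (hZ : MDiffAt (T% Z) x) :
    2 * inner ℝ (leviCivitaAt Y x (X x)) (Z x) = koszul X Y Z x := by
  rw [leviCivitaAt, dif_pos hY]
  exact (exists_koszul hY).choose_spec X Z hX hZ

/-- The Levi-Civita connection of a Riemannian manifold: the metric, torsion-free connection on
the tangent bundle (see `leviCivita_metric` and `leviCivita_torsion` below). As everywhere in
Mathlib, `leviCivita Y x (X x)` stands for `(∇_X Y)(x)`. -/
def leviCivita : CovariantDerivative I E (fun x : M ↦ TangentSpace I x) where
  toFun := leviCivitaAt
  isCovariantDerivativeOnUniv :=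
    { add := fun {Y Y' x} hY hY' _ ↦ by
        refine eq_of_inner_eq fun X Z hX hZ ↦ ?_
        rw [inner_leviCivitaAt hX (mdifferentiableAt_add_section hY hY') hZ, koszul_add_mid hX hY hY' hZ,
          ← inner_leviCivitaAt hX hY hZ, ← inner_leviCivitaAt hX hY' hZ,
          add_apply, inner_add_left]
        ring
      leibniz := fun {Y f x} hY hf _ ↦ by
        refine eq_of_inner_eq fun X Z hX hZ ↦ ?_
        rw [inner_leviCivitaAt hX (hf.smul_section hY) hZ, koszul_smul_mid hf hX hY hZ,
          ← inner_leviCivitaAt hX hY hZ, add_apply, inner_add_left]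
        simp [real_inner_smul_left]
        ring }

theorem inner_leviCivita (hX : MDiffAt (T% X) x) (hY : MDiffAt (T% Y) x)
    (hZ : MDiffAt (T% Z) x) :
    2 * inner ℝ (leviCivita Y x (X x)) (Z x) = koszul X Y Z x :=
  inner_leviCivitaAt hX hY hZ

/-- The Levi-Civita connection is metric: `X⟨Y, Z⟩ = ⟨∇_X Y, Z⟩ + ⟨Y, ∇_X Z⟩`. -/
theorem leviCivita_metric (hX : MDiffAt (T% X) x) (hY : MDiffAt (T% Y) x)
    (hZ : MDiffAt (T% Z) x) :
    mvfderiv I (fun y ↦ inner ℝ (Y y) (Z y)) x (X x) =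
      inner ℝ (leviCivita Y x (X x)) (Z x) + inner ℝ (Y x) (leviCivita Z x (X x)) := by
  have h₁ := inner_leviCivita hX hY hZ
  have h₂ := inner_leviCivita hX hZ hY
  have h₃ : VectorField.mlieBracket I Z Y x = - VectorField.mlieBracket I Y Z x :=
    VectorField.mlieBracket_swap_apply
  rw [real_inner_comm (leviCivita Z x (X x))]
  simp only [koszul, h₃, inner_neg_left, inner_fun_comm Z Y] at h₁ h₂
  linarith

/-- The Levi-Civita connection is torsion-free. -/
theorem leviCivita_torsion [CompleteSpace E] :
    (leviCivita : CovariantDerivative I E (fun x : M ↦ TangentSpace I x)).torsion = 0 := by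
  rw [CovariantDerivative.torsion_eq_zero_iff]
  intro X Y x hX hY
  refine ext_inner_right ℝ fun w ↦ ?_
  obtain ⟨Z, hZ, rfl⟩ : ∃ Z : ∀ x : M, TangentSpace I x, MDiffAt (T% Z) x ∧ Z x = w :=
    ⟨FiberBundle.extend E w, FiberBundle.mdifferentiableAt_extend .., by simp⟩
  have h₁ := inner_leviCivita hX hY hZ
  have h₂ := inner_leviCivita hY hX hZ
  have h₃ : VectorField.mlieBracket I Y X x = - VectorField.mlieBracket I X Y x :=
    VectorField.mlieBracket_swap_apply
  simp only [koszul, h₃, inner_neg_left, inner_fun_comm Y X] at h₁ h₂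
  rw [inner_sub_left]
  linarith
/-- `R(U,V) W = ∇_U ∇_V W - ∇_V ∇_U W - ∇_{[U,V]} W`, as an operator on vector fields. -/
def curvatureOperator (U V W : ∀ x : M, TangentSpace I x) (x : M) : TangentSpace I x :=
  leviCivita (fun y ↦ leviCivita W y (V y)) x (U x)
    - leviCivita (fun y ↦ leviCivita W y (U y)) x (V x)
    - leviCivita W x (VectorField.mlieBracket I U V x)

/-- The curvature endomorphism `R(U,V)_x` of `T_x M`. The operator `R(U,V)` is tensorial, so it is
determined at `x` by its values on smooth fields (defined near `x`) that extend a basis of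
`T_x M`; the endomorphism is the linear map with these values. -/
def curvatureEndomorphism (U V : ∀ x : M, TangentSpace I x) (x : M) :
    TangentSpace I x →L[ℝ] TangentSpace I x :=
  have : FiniteDimensional ℝ (TangentSpace I x) := inferInstanceAs (FiniteDimensional ℝ E)
  LinearMap.toContinuousLinearMap
    ((Module.finBasis ℝ (TangentSpace I x)).constr ℝ fun i ↦
      curvatureOperator U V (FiberBundle.extend E (Module.finBasis ℝ (TangentSpace I x) i)) x)

end

section

variable {E : Type*} [NormedAddCommGroup E] [NormedSpace ℝ E]
  {H : Type*} [TopologicalSpace H] {I : ModelWithCorners ℝ E H}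
  {M : Type*} [TopologicalSpace M] [ChartedSpace H M]

/-- The exponential `∑ Aⁿ / n!` of an endomorphism of a tangent space. As a topological vector
space the tangent space is the model space `E`, whose norm is used to sum the series. -/
noncomputable def expEndomorphism {x : M} (A : TangentSpace I x →L[ℝ] TangentSpace I x) :
    TangentSpace I x →L[ℝ] TangentSpace I x :=
  (NormedSpace.exp (A : E →L[ℝ] E) : E →L[ℝ] E)

variable [IsManifold I ∞ M]

/-- A smooth vector field. -/
def IsSmoothField (U : ∀ x : M, TangentSpace I x) : Prop :=
  ContMDiff I I.tangent ∞ (fun x ↦ (⟨x, U x⟩ : TangentBundle I M))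

/-- A vector bundle automorphism of `TM`: a diffeomorphism of `TM` onto itself which maps every
fibre linearly to itself. -/
def IsVectorBundleAutomorphism (S : ∀ x : M, TangentSpace I x →L[ℝ] TangentSpace I x) : Prop :=
  ∃ Φ : Diffeomorph I.tangent I.tangent (TangentBundle I M) (TangentBundle I M) ∞,
    ∀ (x : M) (v : TangentSpace I x), Φ ⟨x, v⟩ = ⟨x, S x v⟩

/-- A vector bundle endomorphism is unipotent if it restricts to a unipotent map on each fibre. -/
def IsUnipotentOnFibers (S : ∀ x : M, TangentSpace I x →L[ℝ] TangentSpace I x) : Prop :=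
  ∀ x : M, ∃ m : ℕ, (S x - 1) ^ m = 0

end

end RiemannianGeometry

namespace KahlerGeometry

open RiemannianGeometry

section

variable {E : Type*} [NormedAddCommGroup E] [NormedSpace ℂ E]
  {X : Type*} [TopologicalSpace X] [ChartedSpace E X]

/-- A complex manifold is in particular a smooth real manifold. -/
instance isManifold_real [IsManifold 𝓘(ℂ, E) ω X] : IsManifold 𝓘(ℝ, E) ∞ X := by
  have : IsManifold 𝓘(ℝ, E) ω X := by
    refine isManifold_of_contDiffOn _ _ _ fun e e' he he' ↦ ?_
    have h := (contDiffGroupoid ω 𝓘(ℂ, E)).compatible he he'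
    rw [contDiffGroupoid, mem_groupoid_of_pregroupoid] at h
    exact h.1.restrict_scalars ℝ
  infer_instance

/-- The complex structure `J` of a complex manifold, as an endomorphism of its real tangent
bundle: multiplication by `i` in the holomorphic chart at `x`, by which Mathlib identifies `T_x X`
with the model space `E`. As the coordinate changes are holomorphic, any other holomorphic chart
gives the same endomorphism. -/
noncomputable def complexStructure (x : X) :
    TangentSpace 𝓘(ℝ, E) x →L[ℝ] TangentSpace 𝓘(ℝ, E) x :=
  (Complex.I • ContinuousLinearMap.id ℝ E : E →L[ℝ] E)

variable [RiemannianBundle (fun x : X ↦ TangentSpace 𝓘(ℝ, E) x)]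

/-- The fundamental form `ω(u, v) = ⟨J u, v⟩`. -/
noncomputable def fundamentalForm (x : X) (u v : TangentSpace 𝓘(ℝ, E) x) : ℝ :=
  inner ℝ (complexStructure x u) v

variable [IsManifold 𝓘(ℂ, E) ω X]

/-- The value `dω(A, B, C)` of the exterior derivative of the fundamental form on three vector
fields. -/
noncomputable def extDerivFundamentalForm (A B C : ∀ x : X, TangentSpace 𝓘(ℝ, E) x) (x : X) : ℝ :=
  mvfderiv 𝓘(ℝ, E) (fun y ↦ fundamentalForm y (B y) (C y)) x (A x)
    - mvfderiv 𝓘(ℝ, E) (fun y ↦ fundamentalForm y (A y) (C y)) x (B x)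
    + mvfderiv 𝓘(ℝ, E) (fun y ↦ fundamentalForm y (A y) (B y)) x (C x)
    - fundamentalForm x (VectorField.mlieBracket 𝓘(ℝ, E) A B x) (C x)
    + fundamentalForm x (VectorField.mlieBracket 𝓘(ℝ, E) A C x) (B x)
    - fundamentalForm x (VectorField.mlieBracket 𝓘(ℝ, E) B C x) (A x)

variable (E X) in
/-- The given Riemannian metric on the complex manifold `X` is a Kähler metric: it is Hermitian
and its fundamental form is closed. -/
structure IsKahler : Prop where
  hermitian : ∀ (x : X) (u v : TangentSpace 𝓘(ℝ, E) x),
    inner ℝ (complexStructure x u) (complexStructure x v) = inner ℝ u v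
  closed : ∀ A B C : ∀ x : X, TangentSpace 𝓘(ℝ, E) x,
    IsSmoothField A → IsSmoothField B → IsSmoothField C →
      ∀ x : X, extDerivFundamentalForm A B C x = 0

/-- A vector bundle automorphism of `TX` which preserves the fundamental form. -/
def IsSymplecticAutomorphism
    (S : ∀ x : X, TangentSpace 𝓘(ℝ, E) x →L[ℝ] TangentSpace 𝓘(ℝ, E) x) : Prop :=
  IsVectorBundleAutomorphism S ∧
    ∀ (x : X) (u v : TangentSpace 𝓘(ℝ, E) x),
      fundamentalForm x (S x u) (S x v) = fundamentalForm x u v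

end

end KahlerGeometry

/-! Why $\exp(R(U,V))$ is symplectic. On a Kähler manifold $J$ is parallel, so $R(U,V)$ commutes
with $J$. It is also skew for the metric, hence skew for $\omega$: fibrewise it lies in the
symplectic Lie algebra, and its exponential preserves $\omega$. That $J$ is parallel follows from
`koszul_add_koszul`, which expresses $\nabla J$ through $d\omega$ and the Nijenhuis tensor; the
latter vanishes because $J$ is multiplication by $i$ in holomorphic charts. Metric compatibility
makes the curvature operator skew-adjoint, and this already forces it to act pointwise
(`curvatureEndomorphism_apply`).

The linear factorization (`exists_unipotent_factorization`). A transvection $u \mapsto u +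
c\,\Omega(u,v)v$ is symplectic and unipotent. By polarization, the tensors $v \otimes v$ with $v =
b_i \pm b_j$ span all symmetric tensors, which form the symplectic Lie algebra once $\Omega$ is used
to identify vectors and covectors. The inverse function theorem, with $\Omega$ as a parameter, then
writes every symplectic $S$ near $1$ as a product of such transvections whose coefficients are
smooth in $(\Omega, S)$ and vanish at $S = 1$. The Cayley transform avoids treating the symplectic
group as a manifold: it turns the symplectic condition into the linear condition of being a
symmetric tensor.

The globalization. Because the coefficients vanish at $S = 1$, an automorphism that is close to the
identity and supported in a small set factors with factors extended by the identity
(`exists_mem_closure_unipotentAutomorphisms`). For a field $A$ in the Lie algebra and a partition of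
unity $\rho_i$, finite by compactness, $\exp A = \prod_i \exp(\rho_i A)$, since multiples of $A$
commute. Each $\exp(\rho_i A)$ is the $K$-th power of $\exp(\rho_i A/K)$, which is close to the
identity for large $K$. -/

open Topology Filter

/-! ### Products of families in a normed algebra -/

section HasFDerivAtListProd

variable {P A K : Type*} [NormedAddCommGroup P] [NormedSpace ℝ P] [NormedRing A]
  [NormedAlgebra ℝ A]

theorem List.prod_map_eq_one {M : Type*} [Monoid M] {l : List K} {f : K → M}
    (h : ∀ k ∈ l, f k = 1) : (l.map f).prod = 1 :=
  List.prod_eq_one fun x hx ↦ by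
    obtain ⟨k, hk, rfl⟩ := List.mem_map.1 hx
    exact h k hk

/-- In the Leibniz rule at a point where all factors are `1`, each term reduces to the derivative of
a single factor, so the order of multiplication is invisible to first order. -/
theorem hasFDerivAt_list_prod_of_eq_one (l : List K) {f : K → P → A} {f' : K → P →L[ℝ] A} {p : P}
    (hf : ∀ k, HasFDerivAt (f k) (f' k) p) (h1 : ∀ k, f k p = 1) :
    HasFDerivAt (fun q ↦ (l.map fun k ↦ f k q).prod) (l.map f').sum p := by
  induction l with
  | nil => simpa using hasFDerivAt_const (1 : A) p
  | cons k l ih =>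
    have h := (hf k).mul' ih
    simp only [List.map_cons, List.prod_cons, List.sum_cons]
    refine h.congr_fderiv ?_
    rw [h1 k, List.prod_map_eq_one fun k _ ↦ h1 k]
    ext v
    simp [add_comm]

theorem contDiffAt_list_prod (l : List K) {f : K → P → A} {p : P} {n : ℕ∞ω}
    (hf : ∀ k, ContDiffAt ℝ n (f k) p) : ContDiffAt ℝ n (fun q ↦ (l.map fun k ↦ f k q).prod) p := by
  induction l with
  | nil => simpa using contDiffAt_const
  | cons k l ih => simpa using (hf k).mul ih

end HasFDerivAtListProd

/-! ### Symplectic linear algebra: transvections and the Cayley transform -/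

namespace SymplecticForm
noncomputable section

variable {E : Type*} [NormedAddCommGroup E] [NormedSpace ℝ E]

/-- The endomorphism preserves the bilinear form. -/
def Preserves (Ω : E →L[ℝ] E →L[ℝ] ℝ) (S : E →L[ℝ] E) : Prop :=
  ∀ u v, Ω (S u) (S v) = Ω u v

theorem skew_of_alternating {Ω : E →L[ℝ] E →L[ℝ] ℝ} (h : ∀ u, Ω u u = 0) (u v : E) :
    Ω u v = - Ω v u := by
  have := h (u + v)
  simp only [map_add, add_apply, h] at this
  linarith

/-- The square-zero endomorphism `u ↦ Ω(u, v) v`. -/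
def rankOne (v : E) : (E →L[ℝ] E →L[ℝ] ℝ) →L[ℝ] E →L[ℝ] E :=
  (ContinuousLinearMap.smulRightL ℝ E E).flip v ∘L
    (ContinuousLinearMap.apply ℝ (E →L[ℝ] ℝ) v ∘L
      (ContinuousLinearMap.flipₗᵢ ℝ E E ℝ).toContinuousLinearEquiv.toContinuousLinearMap)

@[simp]
theorem rankOne_apply (v : E) (Ω : E →L[ℝ] E →L[ℝ] ℝ) (u : E) : rankOne v Ω u = Ω u v • v := by
  simp [rankOne]

variable {Ω : E →L[ℝ] E →L[ℝ] ℝ}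

/-- The two terms linear in `c` cancel by skew-symmetry, and the quadratic one contains the factor
`Ω v v = 0`. -/
theorem preserves_one_add_smul_rankOne (h : ∀ u, Ω u u = 0) (c : ℝ) (v : E) :
    Preserves Ω (1 + c • rankOne v Ω) := by
  intro u w
  have := skew_of_alternating h v w
  simp [h, this]
  ring

theorem rankOne_mul_self (h : ∀ u, Ω u u = 0) (v : E) : rankOne v Ω * rankOne v Ω = 0 := by
  ext u
  simp [h]

theorem Preserves.one : Preserves Ω (1 : E →L[ℝ] E) := fun _ _ ↦ rfl

theorem Preserves.mul {S T : E →L[ℝ] E} (hS : Preserves Ω S) (hT : Preserves Ω T) :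
    Preserves Ω (S * T) := fun u v ↦ by
  rw [mul_apply_eq_comp, mul_apply_eq_comp, hS, hT]

theorem Preserves.list_prod {l : List (E →L[ℝ] E)} (h : ∀ S ∈ l, Preserves Ω S) :
    Preserves Ω l.prod := by
  induction l with
  | nil => simpa using Preserves.one
  | cons S l ih =>
    rw [List.prod_cons]
    exact (h S (by simp)).mul (ih fun T hT ↦ h T (by simp [hT]))

/-- Half of the Cayley transform is taken with values in the Lie algebra of the symplectic
group. -/
def cayley (S : E →L[ℝ] E) : E →L[ℝ] E := (S - 1) * Ring.inverse (S + 1)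

/-- Since `S - 1 = (S + 1) - 2`, the transform equals `1 - 2 (S + 1)⁻¹`, from which `S` can be
recovered. -/
theorem cayley_injOn {S T : E →L[ℝ] E} (hS : IsUnit (S + 1)) (hT : IsUnit (T + 1))
    (h : cayley S = cayley T) : S = T := by
  have aux {S : E →L[ℝ] E} (hS : IsUnit (S + 1)) :
      cayley S = 1 - 2 * Ring.inverse (S + 1) := by
    have e : S - 1 = (S + 1) - 2 := by rw [← one_add_one_eq_two]; abel
    rw [cayley, e, sub_mul, Ring.mul_inverse_cancel _ hS]
  rw [aux hS, aux hT, sub_right_inj] at h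
  have h' : Ring.inverse (S + 1) = Ring.inverse (T + 1) := by
    have h2 : (2 : ℝ) • Ring.inverse (S + 1) = (2 : ℝ) • Ring.inverse (T + 1) := by
      rw [two_smul, two_smul, ← two_mul, ← two_mul, h]
    exact smul_right_injective _ two_ne_zero h2
  have := congrArg Ring.inverse h'
  rw [Ring.inverse_inverse hS, Ring.inverse_inverse hT] at this
  exact add_right_cancel this

/-- After substituting `u = (S + 1) a` and `v = (S + 1) b`, the claim compares `Ω ((S - 1) a) ((S +
1) b)` with `Ω ((S + 1) a) ((S - 1) b)`, and the expansion uses only `Ω (S a) (S b) = Ω a b`. The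
quadratic condition on `S` has become a linear one. -/
theorem Preserves.cayley_skew {S : E →L[ℝ] E} (hS : Preserves Ω S) (hu : IsUnit (S + 1))
    (u v : E) : Ω (cayley S u) v = - Ω u (cayley S v) := by
  have e (w : E) : (S + 1) (Ring.inverse (S + 1) w) = w := by
    rw [← mul_apply_eq_comp, Ring.mul_inverse_cancel _ hu,
      one_apply_eq_self]
  obtain ⟨a, rfl⟩ : ∃ a, u = (S + 1) a := ⟨_, (e u).symm⟩
  obtain ⟨b, rfl⟩ : ∃ b, v = (S + 1) b := ⟨_, (e v).symm⟩
  have c (a : E) : cayley S ((S + 1) a) = (S - 1) a := by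
    rw [cayley, mul_apply_eq_comp, ← mul_apply_eq_comp _ _ a,
      Ring.inverse_mul_cancel _ hu, one_apply_eq_self]
  rw [c, c]
  have := hS a b
  simp
  linarith

theorem hasFDerivAt_mul_of_eq_zero {P A : Type*} [NormedAddCommGroup P] [NormedSpace ℝ P]
    [NormedRing A] [NormedAlgebra ℝ A] {f g : P → A} {f' : P →L[ℝ] A} {p : P}
    (hf : HasFDerivAt f f' p) (hg : DifferentiableAt ℝ g p) (h0 : f p = 0) :
    HasFDerivAt (fun q ↦ f q * g q) ((ContinuousLinearMap.mul ℝ A).flip (g p) ∘L f') p := by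
  refine (hf.mul' hg.hasFDerivAt).congr_fderiv ?_
  ext v
  simp [h0]

variable [FiniteDimensional ℝ E]

/-- At the identity `S - 1` vanishes, so the derivative of the inverse does not contribute; the
factor `1 / 2` is the value of `(S + 1)⁻¹`. -/
theorem hasFDerivAt_cayley {P : Type*} [NormedAddCommGroup P] [NormedSpace ℝ P]
    {f : P → E →L[ℝ] E} {f' : P →L[ℝ] E →L[ℝ] E} {p : P} (hf : HasFDerivAt f f' p)
    (h1 : f p = 1) : HasFDerivAt (fun q ↦ cayley (f q)) ((1 / 2 : ℝ) • f') p := by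
  have := FiniteDimensional.complete ℝ E
  obtain ⟨w, hw, hw'⟩ : ∃ w : (E →L[ℝ] E)ˣ, (w : E →L[ℝ] E) = f p + 1 ∧
      ((w⁻¹ : (E →L[ℝ] E)ˣ) : E →L[ℝ] E) = (1 / 2 : ℝ) • 1 :=
    ⟨⟨(2 : ℝ) • 1, (1 / 2 : ℝ) • 1, by simp, by simp⟩, by rw [h1, ← two_smul ℝ], rfl⟩
  have hg : DifferentiableAt ℝ (fun q ↦ Ring.inverse (f q + 1)) p := by
    refine DifferentiableAt.comp (g := Ring.inverse) p ?_ (hf.differentiableAt.add_const 1)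
    rw [← hw]
    exact differentiableAt_inverse ⟨w, rfl⟩
  have hi : Ring.inverse (f p + 1) = (1 / 2 : ℝ) • 1 := by
    rw [← hw, Ring.inverse_unit, hw']
  refine (hasFDerivAt_mul_of_eq_zero (hf.sub_const 1) hg (by simp [h1])).congr_fderiv ?_
  ext v u
  simp [hi]

theorem contDiffAt_cayley {S : E →L[ℝ] E} (h : IsUnit (S + 1)) {n : ℕ∞ω} :
    ContDiffAt ℝ n cayley S := by
  have := FiniteDimensional.complete ℝ E
  obtain ⟨w, hw⟩ := h
  refine (contDiffAt_id.sub contDiffAt_const).mul ?_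
  have := contDiffAt_ringInverse (n := n) ℝ w
  rw [hw] at this
  exact this.comp S (contDiffAt_id.add contDiffAt_const)

omit [FiniteDimensional ℝ E] in
theorem isUnit_one_add_one : IsUnit ((1 : E →L[ℝ] E) + 1) :=
  ⟨⟨(2 : ℝ) • 1, (1 / 2 : ℝ) • 1, by simp, by simp⟩, two_smul ℝ 1⟩

/-! ### Local factorization into transvections by the inverse function theorem -/

section Parametrization

variable {ι : Type*} [Fintype ι] (b : Module.Basis ι ℝ E)

set_option linter.unusedSectionVars false
set_option synthInstance.maxHeartbeats 200000

/-- The basis functionals. -/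
def dualFunctional (i : ι) : E →L[ℝ] ℝ := LinearMap.toContinuousLinearMap (b.coord i)

/-- The matrix of a linear map from the dual space, with respect to a basis. -/
def dualMatrix : ((E →L[ℝ] ℝ) →L[ℝ] E) →L[ℝ] (ι × ι → ℝ) :=
  ContinuousLinearMap.pi fun k ↦
    dualFunctional b k.1 ∘L ContinuousLinearMap.apply ℝ E (dualFunctional b k.2)

@[simp]
theorem dualMatrix_apply (A : (E →L[ℝ] ℝ) →L[ℝ] E) (k : ι × ι) :
    dualMatrix b A k = b.coord k.1 (A (dualFunctional b k.2)) := rfl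

theorem dualMatrix_injective : Function.Injective (dualMatrix b) := by
  intro A B h
  have hA (l : ι) : A (dualFunctional b l) = B (dualFunctional b l) :=
    b.ext_elem fun k ↦ congrFun h (k, l)
  ext α
  have : α = ∑ l, α (b l) • dualFunctional b l := by
    ext v
    conv_lhs => rw [← b.sum_repr v]
    simp [dualFunctional, mul_comm, -Module.Basis.sum_repr]
  rw [this]
  simp [hA]

theorem dualMatrix_symm {A : (E →L[ℝ] ℝ) →L[ℝ] E} (h : ∀ α β : E →L[ℝ] ℝ, α (A β) = β (A α))
    (k : ι × ι) : dualMatrix b A k = dualMatrix b A k.swap :=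
  h (dualFunctional b k.1) (dualFunctional b k.2)

/-- The vector of the transvection with index `k`. -/
def direction (k : (ι × ι) × Bool) : E := if k.2 then b k.1.1 + b k.1.2 else b k.1.1 - b k.1.2

/-- The coefficient of the transvection with index `k`. -/
def coefficient (k : (ι × ι) × Bool) : (ι × ι → ℝ) →L[ℝ] ℝ :=
  (if k.2 then (1 / 4 : ℝ) else -(1 / 4 : ℝ)) • ContinuousLinearMap.proj (φ := fun _ ↦ ℝ) k.1

/-- A symplectic transvection with respect to the form `Ω`. -/
def transvection (k : (ι × ι) × Bool) (Ω : E →L[ℝ] E →L[ℝ] ℝ) (s : ι × ι → ℝ) : E →L[ℝ] E :=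
  1 + coefficient k s • rankOne (direction b k) Ω

/-- The product of the transvections in all directions. -/
def transvectionProd (Ω : E →L[ℝ] E →L[ℝ] ℝ) (s : ι × ι → ℝ) : E →L[ℝ] E :=
  ((Finset.univ : Finset ((ι × ι) × Bool)).toList.map fun k ↦ transvection b k Ω s).prod

theorem transvection_zero (k : (ι × ι) × Bool) (Ω : E →L[ℝ] E →L[ℝ] ℝ) :
    transvection b k Ω 0 = 1 := by simp [transvection]

theorem transvectionProd_zero (Ω : E →L[ℝ] E →L[ℝ] ℝ) : transvectionProd b Ω 0 = 1 :=
  List.prod_map_eq_one fun k _ ↦ transvection_zero b k Ω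

theorem preserves_transvection (h : ∀ u, Ω u u = 0) (k : (ι × ι) × Bool) (s : ι × ι → ℝ) :
    Preserves Ω (transvection b k Ω s) := preserves_one_add_smul_rankOne h _ _

theorem preserves_transvectionProd (h : ∀ u, Ω u u = 0) (s : ι × ι → ℝ) :
    Preserves Ω (transvectionProd b Ω s) :=
  Preserves.list_prod fun S hS ↦ by
    obtain ⟨k, -, rfl⟩ := List.mem_map.1 hS
    exact preserves_transvection b h k s

theorem transvection_sub_one_sq (h : ∀ u, Ω u u = 0) (k : (ι × ι) × Bool) (s : ι × ι → ℝ) :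
    (transvection b k Ω s - 1) ^ 2 = 0 := by
  rw [transvection, add_sub_cancel_left, sq, smul_mul_smul_comm, rankOne_mul_self h, smul_zero]

/-- The components of `2 (P - 1) (P + 1)⁻¹ Ω⁻¹`, where `P` is the product of the transvections,
corrected by the antisymmetric part of the parameter. -/
def localChart (Ω : E →L[ℝ] E →L[ℝ] ℝ) (s : ι × ι → ℝ) : ι × ι → ℝ :=
  dualMatrix b ((2 : ℝ) • (cayley (transvectionProd b Ω s) ∘L Ω.inverse)) +
    fun k ↦ (s k - s k.swap) / 2

section Smooth

variable {Q : Type*} [NormedAddCommGroup Q] [NormedSpace ℝ Q] {f : Q → E →L[ℝ] E →L[ℝ] ℝ}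
  {g : Q → ι × ι → ℝ} {g' : Q →L[ℝ] ι × ι → ℝ} {q : Q} {n : ℕ∞ω}

theorem contDiffAt_transvection (hf : ContDiffAt ℝ n f q) (hg : ContDiffAt ℝ n g q)
    (k : (ι × ι) × Bool) : ContDiffAt ℝ n (fun q ↦ transvection b k (f q) (g q)) q := by
  have h₁ : ContDiffAt ℝ n (fun q ↦ coefficient k (g q)) q :=
    contDiffAt_const.clm_apply hg
  have h₂ : ContDiffAt ℝ n (fun q ↦ rankOne (direction b k) (f q)) q :=
    contDiffAt_const.clm_apply hf
  exact contDiffAt_const.add (h₁.smul h₂)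

theorem contDiffAt_transvectionProd (hf : ContDiffAt ℝ n f q) (hg : ContDiffAt ℝ n g q) :
    ContDiffAt ℝ n (fun q ↦ transvectionProd b (f q) (g q)) q :=
  contDiffAt_list_prod _ fun k ↦ contDiffAt_transvection b hf hg k

theorem hasFDerivAt_transvection (hf : ContDiffAt ℝ 1 f q) (hg : HasFDerivAt g g' q)
    (h0 : g q = 0) (k : (ι × ι) × Bool) :
    HasFDerivAt (fun q ↦ transvection b k (f q) (g q))
      ((coefficient k ∘L g').smulRight (rankOne (direction b k) (f q))) q := by
  have h₁ : HasFDerivAt (fun q ↦ coefficient k (g q)) (coefficient k ∘L g') q :=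
    (coefficient k).hasFDerivAt.comp q hg
  have h₂ : DifferentiableAt ℝ (fun q ↦ rankOne (direction b k) (f q)) q :=
    (contDiffAt_const.clm_apply hf).differentiableAt one_ne_zero
  refine ((h₁.smul h₂.hasFDerivAt).const_add 1).congr_fderiv ?_
  ext v u
  simp [h0]

theorem hasFDerivAt_transvectionProd (hf : ContDiffAt ℝ 1 f q) (hg : HasFDerivAt g g' q)
    (h0 : g q = 0) : HasFDerivAt (fun q ↦ transvectionProd b (f q) (g q))
      (∑ k, (coefficient k ∘L g').smulRight (rankOne (direction b k) (f q))) q := by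
  refine (hasFDerivAt_list_prod_of_eq_one _ (fun k ↦ hasFDerivAt_transvection b hf hg h0 k)
    fun k ↦ by rw [h0, transvection_zero]).congr_fderiv ?_
  rw [Finset.sum_map_toList]

/-- The infinitesimal action of the parameters is by symmetric tensors. -/
theorem sum_transvectionDeriv (s : ι × ι → ℝ) (u : E) :
    (∑ k, coefficient k s • rankOne (direction b k) Ω) u =
      ∑ k : ι × ι, (s k / 2) • (Ω u (b k.1) • b k.2 + Ω u (b k.2) • b k.1) := by
  rw [Fintype.sum_prod_type, sum_apply]
  refine Finset.sum_congr rfl fun k _ ↦ ?_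
  -- Polarization: the terms for `b i + b j` and `b i - b j`, with weights `1 / 4` and `-1 / 4`,
  -- cancel except for half of the mixed terms.
  simp only [Fintype.sum_bool, coefficient, direction]
  simp
  module

/-- The parameters with indices `(i, j)` and `(j, i)` multiply the same symmetric tensor, so only
the symmetric part of `s` is seen. The correction term in `localChart` supplies the antisymmetric
part. -/
theorem dualMatrix_sum (s : ι × ι → ℝ) (A : (E →L[ℝ] ℝ) →L[ℝ] E)
    (hA : ∀ α, A α = ∑ k : ι × ι, (s k / 2) • (α (b k.1) • b k.2 + α (b k.2) • b k.1))
    (l : ι × ι) : dualMatrix b A l = (s l + s l.swap) / 2 := by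
  classical
  obtain ⟨i, j⟩ := l
  rw [dualMatrix_apply, hA]
  simp [dualFunctional, Fintype.sum_prod_type, Finsupp.single_apply,
    Finset.sum_add_distrib]
  ring

/-- The inverse function theorem with a parameter: if `g` has derivative `snd`, then `(q.1, g q)`
has the identity as derivative, and the local inverse leaves the parameter in `B` unchanged. -/
theorem exists_openPartialHomeomorph_prodMk {B C : Type*} [NormedAddCommGroup B] [NormedSpace ℝ B]
    [CompleteSpace B] [NormedAddCommGroup C] [NormedSpace ℝ C] [CompleteSpace C] {g : B × C → C}
    {p : B × C} (hg : ContDiffAt ℝ ω g p) (hg' : HasFDerivAt g (ContinuousLinearMap.snd ℝ B C) p) :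
    ∃ e : OpenPartialHomeomorph (B × C) (B × C), (∀ q, e q = (q.1, g q)) ∧ p ∈ e.source ∧
      ContDiffAt ℝ ω e.symm (e p) := by
  have h : ContDiffAt ℝ ω (fun q ↦ (q.1, g q)) p := contDiffAt_fst.prodMk hg
  have h' : HasFDerivAt (fun q ↦ (q.1, g q))
      (ContinuousLinearEquiv.refl ℝ (B × C) : B × C →L[ℝ] B × C) p :=
    (hasFDerivAt_fst.prodMk hg').congr_fderiv rfl
  exact ⟨h.toOpenPartialHomeomorph _ h' (by simp), fun _ ↦ rfl,
    h.mem_toOpenPartialHomeomorph_source h' (by simp), h.to_localInverse h' (by simp)⟩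

/-- At parameter zero the product of transvections is `1` for every form and its Cayley transform
vanishes, so varying the form contributes nothing to first order. The factor `2` in `localChart`
offsets the `1 / 2` from the Cayley transform; what remains is the symmetric part of `g'` plus the
antisymmetric correction, that is `g'` itself. -/
theorem hasFDerivAt_localChart (hf : ContDiffAt ℝ 1 f q) (hg : HasFDerivAt g g' q)
    (h0 : g q = 0) (hi : (f q).IsInvertible) :
    HasFDerivAt (fun q ↦ localChart b (f q) (g q)) g' q := by
  have hP := hasFDerivAt_cayley
    (hasFDerivAt_transvectionProd b hf hg h0)
    (by rw [h0, transvectionProd_zero])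
  have hz : cayley (transvectionProd b (f q) (g q)) = 0 := by
    rw [h0, transvectionProd_zero, cayley, sub_self, zero_mul]
  have hI : DifferentiableAt ℝ (fun q ↦ (f q).inverse) q :=
    ((hi.contDiffAt_map_inverse (n := 1)).comp q hf).differentiableAt one_ne_zero
  have hc := ((hP.clm_comp hI.hasFDerivAt).const_smul (2 : ℝ))
  have hd := (dualMatrix b).hasFDerivAt.comp q hc
  have he : HasFDerivAt (fun q ↦ fun k ↦ (g q k - g q k.swap) / 2)
      (ContinuousLinearMap.pi fun k ↦ (1 / 2 : ℝ) •
        (ContinuousLinearMap.proj (φ := fun _ : ι × ι ↦ ℝ) k ∘L g' -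
          ContinuousLinearMap.proj (φ := fun _ : ι × ι ↦ ℝ) k.swap ∘L g')) q := by
    rw [hasFDerivAt_pi]
    intro k
    have := ((hasFDerivAt_pi'.1 hg k).sub (hasFDerivAt_pi'.1 hg k.swap)).const_smul (1 / 2 : ℝ)
    refine this.congr_of_eventuallyEq (.of_forall fun q ↦ ?_)
    simp
    ring
  refine (hd.add he).congr_fderiv ?_
  ext v l
  have key := dualMatrix_sum b (g' v) ((∑ k, coefficient k (g' v) •
    rankOne (direction b k) (f q)) ∘L (f q).inverse) (fun α ↦ by
      rw [ContinuousLinearMap.comp_apply, sum_transvectionDeriv,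
        hi.self_apply_inverse]) l
  have key' : dualMatrix b ((∑ k, coefficient k (g' v) •
    rankOne (direction b k) (f q)) ∘L (f q).inverse) l = (g' v l + g' v l.swap) / 2 := key
  simp [hz] at key' ⊢
  linarith

theorem contDiffAt_localChart (hf : ContDiffAt ℝ n f q) (hg : ContDiffAt ℝ n g q)
    (hi : (f q).IsInvertible) (hu : IsUnit (transvectionProd b (f q) (g q) + 1)) :
    ContDiffAt ℝ n (fun q ↦ localChart b (f q) (g q)) q := by
  have hP : ContDiffAt ℝ n (fun q ↦ cayley (transvectionProd b (f q) (g q))) q :=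
    ContDiffAt.comp (g := cayley) (f := fun q ↦ transvectionProd b (f q) (g q)) q
      (contDiffAt_cayley hu) (contDiffAt_transvectionProd b hf hg)
  have hI : ContDiffAt ℝ n (fun q ↦ (f q).inverse) q := hi.contDiffAt_map_inverse.comp q hf
  have hd : ContDiffAt ℝ n (fun q ↦ dualMatrix b ((2 : ℝ) •
      (cayley (transvectionProd b (f q) (g q)) ∘L (f q).inverse))) q :=
    contDiffAt_const.clm_apply ((hP.clm_comp hI).const_smul 2)
  refine hd.add (contDiffAt_pi.2 fun k ↦ ?_)
  exact ((contDiffAt_pi.1 hg k).sub (contDiffAt_pi.1 hg k.swap)).div_const 2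

end Smooth

/-- With `α = Ω u` and `β = Ω v` this is skewness of `C` combined with skew-symmetry of `Ω`. It
identifies the symplectic Lie algebra with symmetric tensors. -/
theorem symm_of_skew {C : E →L[ℝ] E} (h : ∀ u, Ω u u = 0) (hi : Ω.IsInvertible)
    (hC : ∀ u v, Ω (C u) v = - Ω u (C v)) (α β : E →L[ℝ] ℝ) :
    α (C (Ω.inverse β)) = β (C (Ω.inverse α)) := by
  obtain ⟨u, rfl⟩ := hi.surjective α
  obtain ⟨v, rfl⟩ := hi.surjective β
  rw [hi.inverse_apply_self, hi.inverse_apply_self, skew_of_alternating h u, hC, neg_neg]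

/-- Both Cayley matrices are symmetric, whereas the correction in `localChart` is antisymmetric.
Averaging `hs` over an index and its swap removes the correction, and injectivity of the Cayley
transform concludes. -/
theorem eq_transvectionProd {S : E →L[ℝ] E} {s : ι × ι → ℝ} (h : ∀ u, Ω u u = 0)
    (hi : Ω.IsInvertible) (hS : Preserves Ω S) (hu : IsUnit (S + 1))
    (hu' : IsUnit (transvectionProd b Ω s + 1))
    (hs : localChart b Ω s = dualMatrix b ((2 : ℝ) • (cayley S ∘L Ω.inverse))) :
    transvectionProd b Ω s = S := by
  have aux {T : E →L[ℝ] E} (hT : Preserves Ω T) (hu : IsUnit (T + 1)) (k : ι × ι) :=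
    dualMatrix_symm b (A := (2 : ℝ) • (cayley T ∘L Ω.inverse)) (fun α β ↦ by
      simpa using symm_of_skew h hi (hT.cayley_skew hu) α β) k
  have h₁ := aux hS hu
  have h₂ := aux (preserves_transvectionProd b h s) hu'
  have h₃ : dualMatrix b ((2 : ℝ) • (cayley (transvectionProd b Ω s) ∘L Ω.inverse)) =
      dualMatrix b ((2 : ℝ) • (cayley S ∘L Ω.inverse)) := by
    funext k
    have e₁ := congrFun hs k
    have e₂ := congrFun hs k.swap
    simp only [localChart, Pi.add_apply, Prod.swap_swap] at e₁ e₂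
    linarith [h₁ k, h₂ k]
  have h₄ := smul_right_injective _ two_ne_zero (dualMatrix_injective b h₃)
  refine cayley_injOn hu' hu ?_
  ext u
  have := congrArg (fun A ↦ A (Ω u)) h₄
  simpa [hi.inverse_apply_self] using this

theorem contDiffAt_dualMatrix_cayley {S : E →L[ℝ] E} (hi : Ω.IsInvertible) (hu : IsUnit (S + 1))
    {n : ℕ∞ω} : ContDiffAt ℝ n (fun p : (E →L[ℝ] E →L[ℝ] ℝ) × (E →L[ℝ] E) ↦
      (p.1, dualMatrix b ((2 : ℝ) • (cayley p.2 ∘L p.1.inverse)))) (Ω, S) := by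
  have h₁ : ContDiffAt ℝ n (fun p : (E →L[ℝ] E →L[ℝ] ℝ) × (E →L[ℝ] E) ↦ cayley p.2) (Ω, S) :=
    ContDiffAt.comp (g := cayley) (f := Prod.snd) (Ω, S) (contDiffAt_cayley hu) contDiffAt_snd
  have h₂ : ContDiffAt ℝ n (fun p : (E →L[ℝ] E →L[ℝ] ℝ) × (E →L[ℝ] E) ↦ p.1.inverse) (Ω, S) :=
    ContDiffAt.comp (g := ContinuousLinearMap.inverse) (f := Prod.fst) (Ω, S)
      hi.contDiffAt_map_inverse contDiffAt_fst
  exact contDiffAt_fst.prodMk (contDiffAt_const.clm_apply ((h₁.clm_comp h₂).const_smul (2 : ℝ)))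

/-- Near the identity, symplectic endomorphisms are products of transvections which depend
analytically on the endomorphism and on the symplectic form. -/
theorem exists_parameter {Ω₀ : E →L[ℝ] E →L[ℝ] ℝ} (hi : Ω₀.IsInvertible) :
    ∃ σ : (E →L[ℝ] E →L[ℝ] ℝ) × (E →L[ℝ] E) → ι × ι → ℝ,
      ContDiffAt ℝ ω σ (Ω₀, 1) ∧ ∀ᶠ p in 𝓝 (Ω₀, (1 : E →L[ℝ] E)), σ (p.1, 1) = 0 ∧
        ((∀ u, p.1 u u = 0) → Preserves p.1 p.2 → transvectionProd b p.1 (σ p) = p.2) := by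
  have := FiniteDimensional.complete ℝ E
  have hΦ := contDiffAt_localChart b (n := ω) (q := (Ω₀, (0 : ι × ι → ℝ))) contDiffAt_fst
    contDiffAt_snd hi (by simpa only [transvectionProd_zero] using isUnit_one_add_one)
  have hΦ' := hasFDerivAt_localChart b (q := (Ω₀, (0 : ι × ι → ℝ))) contDiffAt_fst
    hasFDerivAt_snd rfl hi
  obtain ⟨e, he, hes, hesm⟩ := exists_openPartialHomeomorph_prodMk hΦ hΦ'
  have hΦ0 (Ω : E →L[ℝ] E →L[ℝ] ℝ) : e (Ω, 0) = (Ω, 0) := by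
    simp only [he, localChart, transvectionProd_zero, cayley]
    ext <;> simp
  have het : (Ω₀, 0) ∈ e.target := by
    have := e.map_source hes
    rwa [hΦ0 Ω₀] at this
  have hesymm {Ω : E →L[ℝ] E →L[ℝ] ℝ} (h : (Ω, 0) ∈ e.source) : e.symm (Ω, 0) = (Ω, 0) := by
    have := e.left_inv h
    rwa [hΦ0 Ω] at this
  -- The value of `ζ` at `(Ω, S)` is what `e` should yield if the transvections multiply to `S` and
  -- the antisymmetric correction is zero. Hence `σ` is the second component of `e.symm ∘ ζ`.
  let ζ : (E →L[ℝ] E →L[ℝ] ℝ) × (E →L[ℝ] E) → (E →L[ℝ] E →L[ℝ] ℝ) × (ι × ι → ℝ) :=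
    fun p ↦ (p.1, dualMatrix b ((2 : ℝ) • (cayley p.2 ∘L p.1.inverse)))
  have hζ : ContDiffAt ℝ ω ζ (Ω₀, 1) := contDiffAt_dualMatrix_cayley b hi isUnit_one_add_one
  have hζ1 (Ω : E →L[ℝ] E →L[ℝ] ℝ) : ζ (Ω, 1) = (Ω, 0) := by
    simp only [ζ, cayley]
    ext <;> simp
  have hsymm : ContDiffAt ℝ ω e.symm (ζ (Ω₀, 1)) := by
    rwa [hΦ0, ← hζ1] at hesm
  have hcomp : ContDiffAt ℝ ω (fun p ↦ e.symm (ζ p)) (Ω₀, 1) := hsymm.comp _ hζ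
  refine ⟨fun p ↦ (e.symm (ζ p)).2, contDiffAt_snd.comp _ hcomp, ?_⟩
  have c₁ : ∀ᶠ p in 𝓝 (Ω₀, (1 : E →L[ℝ] E)), ζ p ∈ e.target :=
    hζ.continuousAt (e.open_target.mem_nhds (by rwa [hζ1]))
  have c₂ : ∀ᶠ p in 𝓝 (Ω₀, (1 : E →L[ℝ] E)), (p.1, (0 : ι × ι → ℝ)) ∈ e.source :=
    (continuous_fst.prodMk continuous_const).continuousAt (e.open_source.mem_nhds hes)
  have c₃ : ∀ᶠ p in 𝓝 (Ω₀, (1 : E →L[ℝ] E)), IsUnit (p.2 + 1) :=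
    (continuous_snd.tendsto (Ω₀, (1 : E →L[ℝ] E))).add_const 1
      (Units.isOpen.mem_nhds isUnit_one_add_one)
  have c₄ : ∀ᶠ p in 𝓝 (Ω₀, (1 : E →L[ℝ] E)),
      IsUnit (transvectionProd b (e.symm (ζ p)).1 (e.symm (ζ p)).2 + 1) := by
    refine (((contDiffAt_transvectionProd b (n := ω) (contDiffAt_fst.comp _ hcomp)
      (contDiffAt_snd.comp _ hcomp)).add contDiffAt_const).continuousAt)
        (Units.isOpen.mem_nhds ?_)
    simp only [Function.comp, hζ1, hesymm hes, transvectionProd_zero]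
    exact isUnit_one_add_one
  have c₅ : ∀ᶠ p in 𝓝 (Ω₀, (1 : E →L[ℝ] E)), p.1.IsInvertible := by
    obtain ⟨i, hi⟩ := hi
    exact (continuous_fst.tendsto (Ω₀, (1 : E →L[ℝ] E))).eventually_mem (hi ▸ i.nhds)
  filter_upwards [c₁, c₂, c₃, c₄, c₅] with p h₁ h₂ h₃ h₄ h₅
  -- The parameter vanishes at `S = 1` for all nearby forms, since `e` fixes `(Ω, 0)`. This later
  -- lets the factors be extended by the identity.
  refine ⟨by rw [hζ1, hesymm h₂], fun ha hp ↦ ?_⟩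
  have h₆ : e (e.symm (ζ p)) = ζ p := e.right_inv h₁
  rw [he] at h₆
  have h₇ : (e.symm (ζ p)).1 = p.1 := congrArg Prod.fst h₆
  have h₈ := congrArg Prod.snd h₆
  simp only [h₇] at h₄
  refine eq_transvectionProd b ha h₅ hp h₃ h₄ ?_
  rw [← h₇]
  exact h₈.trans (by rw [h₇])

end Parametrization

/-- Near the identity, symplectic endomorphisms factor into unipotent ones, which depend smoothly
on the endomorphism and on the symplectic form. -/
theorem exists_unipotent_factorization {Ω₀ : E →L[ℝ] E →L[ℝ] ℝ} (hi : Ω₀.IsInvertible) :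
    ∃ L : List ((E →L[ℝ] E →L[ℝ] ℝ) × (E →L[ℝ] E) → E →L[ℝ] E),
      (∀ F ∈ L, ∀ p, (∀ u, p.1 u u = 0) → Preserves p.1 (F p) ∧ (F p - 1) ^ 2 = 0) ∧
      ∀ᶠ p in 𝓝 (Ω₀, (1 : E →L[ℝ] E)),
        (∀ F ∈ L, ContDiffAt ℝ ∞ F p ∧ F (p.1, 1) = 1) ∧
        ((∀ u, p.1 u u = 0) → Preserves p.1 p.2 → (L.map fun F ↦ F p).prod = p.2) := by
  let b := Module.finBasis ℝ E
  obtain ⟨σ, hσ, h⟩ := exists_parameter b hi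
  refine ⟨(Finset.univ.toList).map fun k p ↦ transvection b k p.1 (σ p), ?_, ?_⟩
  · intro F hF p hp
    obtain ⟨k, -, rfl⟩ := List.mem_map.1 hF
    exact ⟨preserves_transvection b hp k _, transvection_sub_one_sq b hp k _⟩
  · filter_upwards [h, hσ.eventually (by simp)] with p hp hσp
    refine ⟨fun F hF ↦ ?_, fun ha hS ↦ ?_⟩
    · obtain ⟨k, -, rfl⟩ := List.mem_map.1 hF
      refine ⟨contDiffAt_transvection b contDiffAt_fst (hσp.of_le le_top) k, ?_⟩
      simp only [hp.1, transvection_zero]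
    · rw [List.map_map]
      exact hp.2 ha hS

/-- The exponential of an infinitesimally symplectic endomorphism is symplectic. -/
theorem preserves_exp {A : E →L[ℝ] E} (hA : ∀ u v, Ω (A u) v = - Ω u (A v)) :
    Preserves Ω (NormedSpace.exp A) := by
  have := FiniteDimensional.complete ℝ E
  intro u v
  let f : ℝ → ℝ := fun t ↦
    Ω (NormedSpace.exp (t • A) u) (NormedSpace.exp (t • A) v)
  have hf (t : ℝ) : HasDerivAt f 0 t := by
    have h := hasDerivAt_exp_smul_const' (𝕂 := ℝ) A t
    have hu := h.clm_apply (hasDerivAt_const t u)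
    have hv := h.clm_apply (hasDerivAt_const t v)
    have hΩ := ((hasDerivAt_const t Ω).clm_apply hu).clm_apply hv
    refine hΩ.congr_deriv ?_
    simp [hA]
  have hc := is_const_of_deriv_eq_zero (fun t ↦ (hf t).differentiableAt) (fun t ↦ (hf t).deriv) 1 0
  simpa [f] using hc

end
end SymplecticForm

/-! ### Families of operators on finite-dimensional spaces -/

section FiniteDimensionalFamilies

variable {E F : Type*} [NormedAddCommGroup E] [NormedSpace ℝ E] [FiniteDimensional ℝ E]
  [NormedAddCommGroup F] [NormedSpace ℝ F] {EM H M : Type*} [NormedAddCommGroup EM]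
  [NormedSpace ℝ EM] [TopologicalSpace H] {I : ModelWithCorners ℝ EM H} [TopologicalSpace M]
  [ChartedSpace H M]

/-- A family of operators on a finite-dimensional space is `C^n` if all its values are. -/
theorem contMDiffAt_of_clm_apply {A : M → E →L[ℝ] F} {x : M} {n : ℕ∞ω}
    (h : ∀ v, ContMDiffAt I 𝓘(ℝ, F) n (fun y ↦ A y v) x) :
    ContMDiffAt I 𝓘(ℝ, E →L[ℝ] F) n A x := by
  let d := Module.finrank ℝ E
  have hd : d = Module.finrank ℝ (Fin d → ℝ) := (Module.finrank_fin_fun ℝ).symm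
  let e₁ := ContinuousLinearEquiv.ofFinrankEq hd
  let e₂ := (e₁.arrowCongr (1 : F ≃L[ℝ] F)).trans (ContinuousLinearEquiv.piRing (Fin d))
  have h' : ContMDiffAt I 𝓘(ℝ, Fin d → F) n (fun y ↦ e₂ (A y)) x :=
    contMDiffAt_pi_space.2 fun i ↦ h _
  have h'' := (e₂.symm.contDiff.contMDiff.contMDiffAt (n := n) (x := e₂ (A x))).comp x h'
  exact h''.congr_of_eventuallyEq (.of_forall fun y ↦ (e₂.symm_apply_apply (A y)).symm)

theorem ContinuousLinearMap.isInvertible_of_nondegenerate {Ω : E →L[ℝ] E →L[ℝ] ℝ}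
    (h : ∀ u, (∀ v, Ω u v = 0) → u = 0) : Ω.IsInvertible := by
  have hinj : Function.Injective Ω := by
    rw [injective_iff_map_eq_zero]
    exact fun u hu ↦ h u fun v ↦ by rw [hu]; rfl
  have hdim : Module.finrank ℝ E = Module.finrank ℝ (E →L[ℝ] ℝ) := by
    rw [← (LinearMap.toContinuousLinearMap : (E →ₗ[ℝ] ℝ) ≃ₗ[ℝ] E →L[ℝ] ℝ).finrank_eq]
    exact (Subspace.dual_finrank_eq (K := ℝ) (V := E)).symm
  refine ⟨(LinearEquiv.ofInjectiveOfFinrankEq (Ω : E →ₗ[ℝ] E →L[ℝ] ℝ) hinj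
    hdim).toContinuousLinearEquiv, ?_⟩
  ext u v
  rfl

end FiniteDimensionalFamilies

theorem natCast_le_infty (n : ℕ) : (n : ℕ∞ω) ≤ ∞ :=
  WithTop.coe_le_coe.2 (le_top : (n : ℕ∞) ≤ ⊤)

/-! ### Smooth vector fields and the Lie bracket -/

namespace RiemannianGeometry
noncomputable section

variable {E : Type*} [NormedAddCommGroup E] [NormedSpace ℝ E]
  {M : Type*} [TopologicalSpace M] [ChartedSpace E M] [IsManifold 𝓘(ℝ, E) ∞ M]
  {U V W : ∀ x : M, TangentSpace 𝓘(ℝ, E) x} {f : M → ℝ}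

theorem IsSmoothField.mdifferentiableAt (hU : IsSmoothField U) (x : M) : MDiffAt (T% U) x :=
  (hU x).mdifferentiableAt (by simp)

theorem IsSmoothField.smul (hf : ContMDiff 𝓘(ℝ, E) 𝓘(ℝ) ∞ f) (hU : IsSmoothField U) :
    IsSmoothField (f • U) := ContMDiff.smul_section hf hU

theorem IsSmoothField.sub (hU : IsSmoothField U) (hV : IsSmoothField V) :
    IsSmoothField (U - V) := ContMDiff.sub_section hU hV

/-- The derivative of a smooth function along a smooth field is smooth. -/
theorem IsSmoothField.contMDiff_mvfderiv (hU : IsSmoothField U)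
    (hf : ContMDiff 𝓘(ℝ, E) 𝓘(ℝ) ∞ f) :
    ContMDiff 𝓘(ℝ, E) 𝓘(ℝ) ∞ fun x ↦ mvfderiv 𝓘(ℝ, E) f x (U x) := by
  have h₁ : ContMDiff 𝓘(ℝ, E).tangent 𝓘(ℝ).tangent ∞ (tangentMap 𝓘(ℝ, E) 𝓘(ℝ) f) :=
    hf.contMDiff_tangentMap (by simp)
  exact (contMDiff_snd_tangentBundle_modelSpace ℝ 𝓘(ℝ)).comp (h₁.comp hU)

theorem IsSmoothField.mlieBracket [CompleteSpace E] (hU : IsSmoothField U)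
    (hV : IsSmoothField V) : IsSmoothField (VectorField.mlieBracket 𝓘(ℝ, E) U V) := by
  have : IsManifold 𝓘(ℝ, E) (((⊤ : ℕ∞) : ℕ∞ω) + 1) M := by simpa
  have : IsManifold 𝓘(ℝ, E) (minSmoothness ℝ 2) M := by
    simpa using IsManifold.of_le (n := ∞) (m := 2) (natCast_le_infty 2)
  exact fun x ↦ ContMDiffAt.mlieBracket_vectorField (m := ⊤) (n := ⊤) (hU x) (hV x) (by simp)

section Cutoff

variable [FiniteDimensional ℝ E] [T2Space M]

theorem exists_cutoff {x : M} {s : Set M} (hs : s ∈ 𝓝 x) :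
    ∃ χ : M → ℝ, ContMDiff 𝓘(ℝ, E) 𝓘(ℝ) ∞ χ ∧ (∀ᶠ y in 𝓝 x, χ y = 1) ∧ tsupport χ ⊆ s :=
  let ⟨χ, _, hχ⟩ := (SmoothBumpFunction.nhds_basis_tsupport (I := 𝓘(ℝ, E)) x).mem_iff.1 hs
  ⟨χ, χ.contMDiff, χ.eventuallyEq_one, hχ⟩

/-- Near every point there are frames that are restrictions of global smooth fields. -/
theorem exists_smoothField_eventuallyEq_symmL {x y : M} (hy : y ∈ (chartAt E x).source) (w : E) :
    ∃ W : ∀ x : M, TangentSpace 𝓘(ℝ, E) x, IsSmoothField W ∧ ∀ᶠ z in 𝓝 y,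
      W z = (trivializationAt E (TangentSpace 𝓘(ℝ, E)) x).symmL ℝ z w := by
  obtain ⟨χ, hχ, h1, hs⟩ := exists_cutoff (E := E) ((chartAt E x).open_source.mem_nhds hy)
  set t := trivializationAt E (TangentSpace 𝓘(ℝ, E)) x
  have h : ContMDiffOn 𝓘(ℝ, E) 𝓘(ℝ, E).tangent ∞
      (fun y ↦ (⟨y, t.symmL ℝ y w⟩ : TangentBundle 𝓘(ℝ, E) M)) t.baseSet := by
    rw [t.contMDiffOn_section_baseSet_iff]
    refine (contMDiffOn_const (c := w)).congr fun y hy ↦ ?_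
    rw [← t.continuousLinearMapAt_apply_of_mem (R := ℝ) hy, t.continuousLinearMapAt_symmL hy]
  refine ⟨χ • fun y ↦ t.symmL ℝ y w,
    ContMDiffOn.smul_section_of_tsupport hχ.contMDiffOn t.open_baseSet hs h, ?_⟩
  filter_upwards [h1] with y hy
  simp [hy, t]

/-- The fields in the definition of `curvatureEndomorphism` are local extensions. A global smooth
field with the same germ can replace them, because covariant derivatives are local. -/
theorem exists_smoothField_eventuallyEq_extend {x : M} (v : TangentSpace 𝓘(ℝ, E) x) :
    ∃ W : ∀ x : M, TangentSpace 𝓘(ℝ, E) x, IsSmoothField W ∧ W x = v ∧ ∀ᶠ y in 𝓝 x,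
      W y = FiberBundle.extend E v y := by
  set t := trivializationAt E (TangentSpace 𝓘(ℝ, E)) x
  obtain ⟨W, hW, h⟩ := exists_smoothField_eventuallyEq_symmL (mem_chart_source E x) (t ⟨x, v⟩).2
  have h' : ∀ᶠ y in 𝓝 x, W y = FiberBundle.extend E v y := by
    filter_upwards [h, t.open_baseSet.mem_nhds (FiberBundle.mem_baseSet_trivializationAt' x)]
      with y hy hb
    rw [hy, t.symmL_apply hb]
    rfl
  exact ⟨W, hW, by simpa using h'.self_of_nhds, h'⟩

theorem exists_smoothField {x : M} (v : TangentSpace 𝓘(ℝ, E) x) :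
    ∃ W : ∀ x : M, TangentSpace 𝓘(ℝ, E) x, IsSmoothField W ∧ W x = v :=
  let ⟨W, hW, h, _⟩ := exists_smoothField_eventuallyEq_extend v
  ⟨W, hW, h⟩

/-- The Lie bracket is the commutator of the directional derivatives. -/
theorem mvfderiv_mlieBracket (hU : IsSmoothField U) (hV : IsSmoothField V)
    (hf : ContMDiff 𝓘(ℝ, E) 𝓘(ℝ) ∞ f) (x : M) :
    mvfderiv 𝓘(ℝ, E) f x (VectorField.mlieBracket 𝓘(ℝ, E) U V x) =
      mvfderiv 𝓘(ℝ, E) (fun y ↦ mvfderiv 𝓘(ℝ, E) f y (V y)) x (U x) -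
        mvfderiv 𝓘(ℝ, E) (fun y ↦ mvfderiv 𝓘(ℝ, E) f y (U y)) x (V x) := by
  have := FiniteDimensional.complete ℝ E
  rcases subsingleton_or_nontrivial E with hE | hE
  · have : Subsingleton (TangentSpace 𝓘(ℝ, E) x) := inferInstanceAs (Subsingleton E)
    rw [Subsingleton.elim (VectorField.mlieBracket 𝓘(ℝ, E) U V x) 0, Subsingleton.elim (U x) 0,
      Subsingleton.elim (V x) 0]
    simp
  -- The Jacobi identity for `U`, `V`, `f • W` is expanded and compared with the one for `U`, `V`,
  -- `W`. The difference is `([U, V] f - U (V f) + V (U f)) • W = 0`, and `W x ≠ 0`.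
  obtain ⟨w, hw⟩ := exists_ne (0 : E)
  obtain ⟨W, hW, rfl⟩ := exists_smoothField (x := x) w
  have hdf (x : M) : MDiffAt f x := (hf x).mdifferentiableAt (by simp)
  have hUf := hU.contMDiff_mvfderiv hf
  have hVf := hV.contMDiff_mvfderiv hf
  have hdU (x : M) : MDiffAt (fun y ↦ mvfderiv 𝓘(ℝ, E) f y (U y)) x :=
    (hUf x).mdifferentiableAt (by simp)
  have hdV (x : M) : MDiffAt (fun y ↦ mvfderiv 𝓘(ℝ, E) f y (V y)) x :=
    (hVf x).mdifferentiableAt (by simp)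
  have e {Y : ∀ x : M, TangentSpace 𝓘(ℝ, E) x} : VectorField.mlieBracket 𝓘(ℝ, E) Y (f • W) =
      (fun y ↦ mvfderiv 𝓘(ℝ, E) f y (Y y)) • W + f • VectorField.mlieBracket 𝓘(ℝ, E) Y W := by
    funext y
    exact VectorField.mlieBracket_smul_right (hdf y) (hW.mdifferentiableAt y)
  have h₁ {Y Z : ∀ x : M, TangentSpace 𝓘(ℝ, E) x} (hY : IsSmoothField Y) (hZ : IsSmoothField Z) :
      VectorField.mlieBracket 𝓘(ℝ, E) Y (VectorField.mlieBracket 𝓘(ℝ, E) Z (f • W)) x =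
        (mvfderiv 𝓘(ℝ, E) (fun y ↦ mvfderiv 𝓘(ℝ, E) f y (Z y)) x (Y x)) • W x +
        (mvfderiv 𝓘(ℝ, E) f x (Z x)) • VectorField.mlieBracket 𝓘(ℝ, E) Y W x +
        ((mvfderiv 𝓘(ℝ, E) f x (Y x)) • VectorField.mlieBracket 𝓘(ℝ, E) Z W x +
        f x • VectorField.mlieBracket 𝓘(ℝ, E) Y (VectorField.mlieBracket 𝓘(ℝ, E) Z W) x) := by
    have hZf := hZ.contMDiff_mvfderiv hf
    have hZW := hZ.mlieBracket hW
    rw [e, VectorField.mlieBracket_add_right ((hW.smul hZf).mdifferentiableAt x)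
        ((hZW.smul hf).mdifferentiableAt x),
      VectorField.mlieBracket_smul_right ((hZf x).mdifferentiableAt (by simp))
        (hW.mdifferentiableAt x),
      VectorField.mlieBracket_smul_right (hdf x) (hZW.mdifferentiableAt x)]
  have J {Z : ∀ x : M, TangentSpace 𝓘(ℝ, E) x} (hZ : IsSmoothField Z) :=
    have : IsManifold 𝓘(ℝ, E) (minSmoothness ℝ 3) M := by
      simpa using IsManifold.of_le (n := ∞) (m := 3) (natCast_le_infty 3)
    VectorField.leibniz_identity_mlieBracket_apply (U := U) (V := V) (W := Z) (x := x)
      (by simpa using (hU x).of_le (natCast_le_infty 2))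
      (by simpa using (hV x).of_le (natCast_le_infty 2))
      (by simpa using (hZ x).of_le (natCast_le_infty 2))
  have J₁ := J (hW.smul hf)
  rw [h₁ hU hV, h₁ hV hU, J hW, e] at J₁
  simp only [Pi.add_apply, Pi.smul_apply'] at J₁
  have h₂ : (mvfderiv 𝓘(ℝ, E) f x (VectorField.mlieBracket 𝓘(ℝ, E) U V x) -
      (mvfderiv 𝓘(ℝ, E) (fun y ↦ mvfderiv 𝓘(ℝ, E) f y (V y)) x (U x) -
        mvfderiv 𝓘(ℝ, E) (fun y ↦ mvfderiv 𝓘(ℝ, E) f y (U y)) x (V x))) • W x = 0 := by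
    refine Eq.trans ?_ (neg_eq_zero.2 (sub_eq_zero.2 J₁))
    module
  exact sub_eq_zero.1 ((smul_eq_zero.1 h₂).resolve_right hw)

end Cutoff

end

/-! ### Smoothness of the Levi-Civita connection and tensoriality of the curvature -/

noncomputable section

variable {E : Type*} [NormedAddCommGroup E] [NormedSpace ℝ E]
  {M : Type*} [TopologicalSpace M] [ChartedSpace E M] [IsManifold 𝓘(ℝ, E) ∞ M]
  [RiemannianBundle (fun x : M ↦ TangentSpace 𝓘(ℝ, E) x)]
  [IsContMDiffRiemannianBundle 𝓘(ℝ, E) ∞ E (fun x : M ↦ TangentSpace 𝓘(ℝ, E) x)]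
  {U V W Z : ∀ x : M, TangentSpace 𝓘(ℝ, E) x}

theorem IsSmoothField.contMDiff_inner (hU : IsSmoothField U) (hV : IsSmoothField V) :
    ContMDiff 𝓘(ℝ, E) 𝓘(ℝ) ∞ fun x ↦ inner ℝ (U x) (V x) :=
  ContMDiff.inner_bundle (IB := 𝓘(ℝ, E)) (F := E) (E := fun x : M ↦ TangentSpace 𝓘(ℝ, E) x)
    (b := fun y ↦ y) hU hV

variable (E M) in
/-- The Riemannian metric as a family of continuous bilinear forms. -/
def metricForm : ∀ x : M, TangentSpace 𝓘(ℝ, E) x →L[ℝ] TangentSpace 𝓘(ℝ, E) x →L[ℝ] ℝ :=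
  (IsContMDiffRiemannianBundle.exists_contMDiff (IB := 𝓘(ℝ, E)) (n := ∞) (F := E)
    (E := fun x : M ↦ TangentSpace 𝓘(ℝ, E) x)).choose

theorem metricForm_apply (x : M) (u v : TangentSpace 𝓘(ℝ, E) x) :
    metricForm E M x u v = inner ℝ u v :=
  ((IsContMDiffRiemannianBundle.exists_contMDiff (IB := 𝓘(ℝ, E)) (n := ∞) (F := E)
    (E := fun x : M ↦ TangentSpace 𝓘(ℝ, E) x)).choose_spec.2 x u v).symm

/-- The bilinear form `⟨S u, v⟩` in the trivialization of the tangent bundle at `x`. -/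
def localForm (S : ∀ x : M, TangentSpace 𝓘(ℝ, E) x →L[ℝ] TangentSpace 𝓘(ℝ, E) x) (x y : M) :
    E →L[ℝ] E →L[ℝ] ℝ :=
  (metricForm E M y).bilinearComp
    (S y ∘L (trivializationAt E (TangentSpace 𝓘(ℝ, E)) x).symmL ℝ y)
    ((trivializationAt E (TangentSpace 𝓘(ℝ, E)) x).symmL ℝ y)

theorem localForm_apply (S : ∀ x : M, TangentSpace 𝓘(ℝ, E) x →L[ℝ] TangentSpace 𝓘(ℝ, E) x)
    (x y : M) (u v : E) : localForm S x y u v =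
      inner ℝ (S y ((trivializationAt E (TangentSpace 𝓘(ℝ, E)) x).symmL ℝ y u))
        ((trivializationAt E (TangentSpace 𝓘(ℝ, E)) x).symmL ℝ y v) := by
  simp only [localForm, ContinuousLinearMap.bilinearComp_apply, metricForm_apply]
  rfl

variable [FiniteDimensional ℝ E]

theorem contMDiff_koszul (hU : IsSmoothField U) (hV : IsSmoothField V) (hW : IsSmoothField W) :
    ContMDiff 𝓘(ℝ, E) 𝓘(ℝ) ∞ (koszul U V W) := by
  have := FiniteDimensional.complete ℝ E
  exact (((((hU.contMDiff_mvfderiv (hV.contMDiff_inner hW)).add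
    (hV.contMDiff_mvfderiv (hU.contMDiff_inner hW))).sub
    (hW.contMDiff_mvfderiv (hU.contMDiff_inner hV))).add
    ((hU.mlieBracket hV).contMDiff_inner hW)).sub
    ((hU.mlieBracket hW).contMDiff_inner hV)).sub
    ((hV.mlieBracket hW).contMDiff_inner hU)

theorem leviCivita_congr {W W' : ∀ x : M, TangentSpace 𝓘(ℝ, E) x} {x : M}
    (hW : MDiffAt (T% W) x) (h : ∀ᶠ y in 𝓝 x, W' y = W y) :
    leviCivita W' x = leviCivita W x := by
  have hW' : MDiffAt (T% W') x := by
    refine hW.congr_of_eventuallyEq ?_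
    filter_upwards [h] with y hy
    rw [hy]
  exact (leviCivita (M := M) (I := 𝓘(ℝ, E))).isCovariantDerivativeOnUniv.congr_of_eventuallyEq
    hW' hW univ_mem h

theorem isInvertible_localForm
    {S : ∀ x : M, TangentSpace 𝓘(ℝ, E) x →L[ℝ] TangentSpace 𝓘(ℝ, E) x} {x y : M}
    (hS : ∀ u, S y u = 0 → u = 0) (hy : y ∈ (chartAt E x).source) :
    (localForm S x y).IsInvertible := by
  have hb : y ∈ (trivializationAt E (TangentSpace 𝓘(ℝ, E)) x).baseSet := hy
  refine ContinuousLinearMap.isInvertible_of_nondegenerate fun u hu ↦ ?_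
  have h₁ : S y ((trivializationAt E (TangentSpace 𝓘(ℝ, E)) x).symmL ℝ y u) = 0 := by
    refine ext_inner_right ℝ fun w ↦ ?_
    have := hu ((trivializationAt E (TangentSpace 𝓘(ℝ, E)) x).continuousLinearMapAt ℝ y w)
    rw [localForm_apply, Trivialization.symmL_continuousLinearMapAt _ hb] at this
    rw [this, inner_zero_left]
  rw [← Trivialization.continuousLinearMapAt_symmL (R := ℝ) _ hb u, hS _ h₁, map_zero]

variable [T2Space M]

theorem contMDiffAt_localForm {S : ∀ x : M, TangentSpace 𝓘(ℝ, E) x →L[ℝ] TangentSpace 𝓘(ℝ, E) x}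
    (hS : ∀ W : ∀ x : M, TangentSpace 𝓘(ℝ, E) x, IsSmoothField W →
      IsSmoothField fun x ↦ S x (W x)) {x y : M}
    (hy : y ∈ (chartAt E x).source) :
    ContMDiffAt 𝓘(ℝ, E) 𝓘(ℝ, E →L[ℝ] E →L[ℝ] ℝ) ∞ (localForm S x) y := by
  refine contMDiffAt_of_clm_apply fun u ↦ contMDiffAt_of_clm_apply fun v ↦ ?_
  obtain ⟨Y, hY, hYu⟩ := exists_smoothField_eventuallyEq_symmL hy u
  obtain ⟨Z, hZ, hZv⟩ := exists_smoothField_eventuallyEq_symmL hy v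
  refine ((hS Y hY).contMDiff_inner hZ y).congr_of_eventuallyEq ?_
  filter_upwards [hYu, hZv] with y h₁ h₂
  rw [localForm_apply, h₁, h₂]

/-- A vector field is smooth if its inner products with all smooth fields are. -/
theorem isSmoothField_of_inner (h : ∀ Z : ∀ x : M, TangentSpace 𝓘(ℝ, E) x, IsSmoothField Z →
    ContMDiff 𝓘(ℝ, E) 𝓘(ℝ) ∞ fun x ↦ inner ℝ (U x) (Z x)) : IsSmoothField U := by
  have := FiniteDimensional.complete ℝ E
  intro x
  set t := trivializationAt E (TangentSpace 𝓘(ℝ, E)) x with ht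
  rw [contMDiffAt_section]
  have hx : x ∈ t.baseSet := FiberBundle.mem_baseSet_trivializationAt' x
  let g : M → E →L[ℝ] E →L[ℝ] ℝ := localForm (fun _ ↦ 1) x
  have hg : ContMDiffAt 𝓘(ℝ, E) 𝓘(ℝ, E →L[ℝ] E →L[ℝ] ℝ) ∞ g x :=
    contMDiffAt_localForm (fun W hW ↦ hW) (mem_chart_source E x)
  have hgi (y : M) (hy : y ∈ t.baseSet) : (g y).IsInvertible :=
    isInvertible_localForm (fun u hu ↦ hu) hy
  have hinv : ContMDiffAt 𝓘(ℝ, E) 𝓘(ℝ, (E →L[ℝ] ℝ) →L[ℝ] E) ∞ (fun y ↦ (g y).inverse) x :=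
    (hgi x hx).contDiffAt_map_inverse.contMDiffAt.comp x hg
  let α : M → E →L[ℝ] ℝ := fun y ↦ metricForm E M y (U y) ∘L t.symmL ℝ y
  have hα : ContMDiffAt 𝓘(ℝ, E) 𝓘(ℝ, E →L[ℝ] ℝ) ∞ α x := by
    refine contMDiffAt_of_clm_apply fun v ↦ ?_
    obtain ⟨Z, hZ, hZv⟩ := exists_smoothField_eventuallyEq_symmL (mem_chart_source E x) v
    refine (h Z hZ x).congr_of_eventuallyEq ?_
    filter_upwards [hZv] with y hy
    simp only [α, ContinuousLinearMap.comp_apply, metricForm_apply]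
    rw [hy]
  refine (hinv.clm_apply hα).congr_of_eventuallyEq ?_
  filter_upwards [t.open_baseSet.mem_nhds hx] with y hy
  rw [← ht, ← t.continuousLinearMapAt_apply_of_mem (R := ℝ) hy]
  have e : α y = g y (t.continuousLinearMapAt ℝ y (U y)) := by
    ext v
    simp only [g, localForm_apply, ← ht, α, ContinuousLinearMap.comp_apply, metricForm_apply]
    rw [t.symmL_continuousLinearMapAt hy]
    rfl
  rw [e, (hgi y hy).inverse_apply_self]

/-- The Levi-Civita derivative of a smooth field along a smooth field is smooth. -/
theorem IsSmoothField.leviCivita (hV : IsSmoothField V) (hW : IsSmoothField W) :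
    IsSmoothField fun x ↦ leviCivita W x (V x) := by
  refine isSmoothField_of_inner fun Z hZ ↦ ?_
  refine (contMDiff_const (c := (1 / 2 : ℝ)).mul (contMDiff_koszul hV hW hZ)).congr fun x ↦ ?_
  have := inner_leviCivita (hV.mdifferentiableAt x) (hW.mdifferentiableAt x)
    (hZ.mdifferentiableAt x)
  simp [← this]

theorem IsSmoothField.curvatureOperator (hU : IsSmoothField U) (hV : IsSmoothField V)
    (hW : IsSmoothField W) : IsSmoothField (curvatureOperator U V W) := by
  have := FiniteDimensional.complete ℝ E
  exact ((hU.leviCivita (hV.leviCivita hW)).sub (hV.leviCivita (hU.leviCivita hW))).sub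
    ((hU.mlieBracket hV).leviCivita hW)

theorem curvatureOperator_congr {W' : ∀ x : M, TangentSpace 𝓘(ℝ, E) x} {x : M}
    (hU : IsSmoothField U) (hV : IsSmoothField V) (hW : IsSmoothField W)
    (h : ∀ᶠ y in 𝓝 x, W' y = W y) :
    RiemannianGeometry.curvatureOperator U V W' x =
      RiemannianGeometry.curvatureOperator U V W x := by
  have h' : ∀ᶠ y in 𝓝 x, leviCivita W' y = leviCivita W y :=
    h.eventually_nhds.mono fun y hy ↦ leviCivita_congr (hW.mdifferentiableAt y) hy
  simp only [RiemannianGeometry.curvatureOperator]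
  have h₁ : ∀ᶠ y in 𝓝 x, leviCivita W' y (V y) = leviCivita W y (V y) :=
    h'.mono fun y hy ↦ by rw [hy]
  have h₂ : ∀ᶠ y in 𝓝 x, leviCivita W' y (U y) = leviCivita W y (U y) :=
    h'.mono fun y hy ↦ by rw [hy]
  rw [h'.self_of_nhds, leviCivita_congr ((hV.leviCivita hW).mdifferentiableAt x) h₁,
    leviCivita_congr ((hU.leviCivita hW).mdifferentiableAt x) h₂]

/-- The curvature operator is skew-adjoint. -/
theorem inner_curvatureOperator (hU : IsSmoothField U) (hV : IsSmoothField V)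
    (hW : IsSmoothField W) (hZ : IsSmoothField Z) (x : M) :
    inner ℝ (curvatureOperator U V W x) (Z x) = - inner ℝ (W x) (curvatureOperator U V Z x) := by
  have := FiniteDimensional.complete ℝ E
  have m {A B C : ∀ x : M, TangentSpace 𝓘(ℝ, E) x} (hA : IsSmoothField A) (hB : IsSmoothField B)
      (hC : IsSmoothField C) (x : M) :=
    leviCivita_metric (hA.mdifferentiableAt x) (hB.mdifferentiableAt x) (hC.mdifferentiableAt x)
  -- In the second derivative of `⟨W, Z⟩` the two mixed terms are exchanged by swapping `A` and `B`,
  -- so they drop out of the commutator.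
  have m₂ {A B : ∀ x : M, TangentSpace 𝓘(ℝ, E) x} (hA : IsSmoothField A) (hB : IsSmoothField B) :
      mvfderiv 𝓘(ℝ, E)
        (fun y ↦ mvfderiv 𝓘(ℝ, E) (fun y ↦ inner ℝ (W y) (Z y)) y (B y)) x (A x) =
      inner ℝ (leviCivita (fun y ↦ leviCivita W y (B y)) x (A x)) (Z x) +
      inner ℝ (leviCivita W x (B x)) (leviCivita Z x (A x)) +
      (inner ℝ (leviCivita W x (A x)) (leviCivita Z x (B x)) +
      inner ℝ (W x) (leviCivita (fun y ↦ leviCivita Z y (B y)) x (A x))) := by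
    have hBW := hB.leviCivita hW
    have hBZ := hB.leviCivita hZ
    rw [← m hA hBW hZ, ← m hA hW hBZ]
    have e : (fun y ↦ mvfderiv 𝓘(ℝ, E) (fun y ↦ inner ℝ (W y) (Z y)) y (B y)) =
        (fun y ↦ inner ℝ (leviCivita W y (B y)) (Z y)) +
          fun y ↦ inner ℝ (W y) (leviCivita Z y (B y)) := funext fun y ↦ m hB hW hZ y
    rw [e, mvfderiv_add ((hBW.contMDiff_inner hZ x).mdifferentiableAt (by simp))
      ((hW.contMDiff_inner hBZ x).mdifferentiableAt (by simp))]
    rfl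
  have h := mvfderiv_mlieBracket hU hV (hW.contMDiff_inner hZ) x
  rw [m₂ hU hV, m₂ hV hU, m (hU.mlieBracket hV) hW hZ] at h
  simp only [RiemannianGeometry.curvatureOperator, inner_sub_left, inner_sub_right]
  linarith

/-- The curvature endomorphism acts on smooth fields as the curvature operator. -/
theorem curvatureEndomorphism_apply (hU : IsSmoothField U) (hV : IsSmoothField V)
    (hW : IsSmoothField W) (x : M) :
    curvatureEndomorphism U V x (W x) = RiemannianGeometry.curvatureOperator U V W x := by
  have : FiniteDimensional ℝ (TangentSpace 𝓘(ℝ, E) x) := inferInstanceAs (FiniteDimensional ℝ E)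
  set b := Module.finBasis ℝ (TangentSpace 𝓘(ℝ, E) x) with hb
  have hext (i) : ∃ Y : ∀ x : M, TangentSpace 𝓘(ℝ, E) x, IsSmoothField Y ∧ Y x = b i ∧
      RiemannianGeometry.curvatureOperator U V (FiberBundle.extend E (b i)) x =
        RiemannianGeometry.curvatureOperator U V Y x := by
    obtain ⟨Y, hY, hx, h⟩ := exists_smoothField_eventuallyEq_extend (b i)
    exact ⟨Y, hY, hx, curvatureOperator_congr hU hV hY (h.mono fun y hy ↦ hy.symm)⟩
  choose Y hY hYx hYe using hext
  have hA : curvatureEndomorphism U V x (W x) =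
      ∑ i, b.repr (W x) i • RiemannianGeometry.curvatureOperator U V (Y i) x := by
    simp only [← hYe]
    simp [curvatureEndomorphism, Module.Basis.constr_apply_fintype, ← hb]
  -- Tensoriality comes from skew-adjointness: `⟨R(U,V) W, Z⟩ = -⟨W, R(U,V) Z⟩` depends on `W` only
  -- through its value at `x`.
  refine ext_inner_right ℝ fun z ↦ ?_
  obtain ⟨Z, hZ, rfl⟩ := exists_smoothField z
  rw [hA, sum_inner, inner_curvatureOperator hU hV hW hZ]
  simp only [real_inner_smul_left, inner_curvatureOperator hU hV (hY _) hZ, hYx]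
  conv_rhs => rw [← b.sum_repr (W x), sum_inner]
  simp [real_inner_smul_left]

end

/-! ### Smooth endomorphisms of the tangent bundle and their exponentials -/

noncomputable section

variable {E : Type*} [NormedAddCommGroup E] [NormedSpace ℝ E]
  {M : Type*} [TopologicalSpace M] [ChartedSpace E M] [IsManifold 𝓘(ℝ, E) ∞ M]
  {S T : ∀ x : M, TangentSpace 𝓘(ℝ, E) x →L[ℝ] TangentSpace 𝓘(ℝ, E) x}

/-- An endomorphism of the tangent bundle in the trivialization at `x`. -/
def localEndomorphism (S : ∀ x : M, TangentSpace 𝓘(ℝ, E) x →L[ℝ] TangentSpace 𝓘(ℝ, E) x)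
    (x y : M) : E →L[ℝ] E :=
  (trivializationAt E (TangentSpace 𝓘(ℝ, E)) x).continuousLinearMapAt ℝ y ∘L S y ∘L
    (trivializationAt E (TangentSpace 𝓘(ℝ, E)) x).symmL ℝ y

theorem localEndomorphism_apply_continuousLinearMapAt {x y : M} (hy : y ∈ (chartAt E x).source)
    (v : TangentSpace 𝓘(ℝ, E) y) : localEndomorphism S x y
      ((trivializationAt E (TangentSpace 𝓘(ℝ, E)) x).continuousLinearMapAt ℝ y v) =
      (trivializationAt E (TangentSpace 𝓘(ℝ, E)) x).continuousLinearMapAt ℝ y (S y v) := by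
  simp only [localEndomorphism, ContinuousLinearMap.comp_apply]
  rw [Trivialization.symmL_continuousLinearMapAt _ hy]

theorem symmL_localEndomorphism {x y : M} (hy : y ∈ (chartAt E x).source)
    (v : E) : (trivializationAt E (TangentSpace 𝓘(ℝ, E)) x).symmL ℝ y (localEndomorphism S x y v) =
      S y ((trivializationAt E (TangentSpace 𝓘(ℝ, E)) x).symmL ℝ y v) := by
  simp only [localEndomorphism, ContinuousLinearMap.comp_apply]
  rw [Trivialization.symmL_continuousLinearMapAt _ hy]

/-- Smoothness of an endomorphism of the tangent bundle. -/
def IsSmoothEndomorphism (S : ∀ x : M, TangentSpace 𝓘(ℝ, E) x →L[ℝ] TangentSpace 𝓘(ℝ, E) x) :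
    Prop :=
  ∀ x : M, ContMDiffAt 𝓘(ℝ, E) 𝓘(ℝ, E →L[ℝ] E) ∞ (localEndomorphism S x) x

theorem IsSmoothEndomorphism.contMDiff (hS : IsSmoothEndomorphism S) :
    ContMDiff 𝓘(ℝ, E).tangent 𝓘(ℝ, E).tangent ∞
      (fun p : TangentBundle 𝓘(ℝ, E) M ↦ (⟨p.1, S p.1 p.2⟩ : TangentBundle 𝓘(ℝ, E) M)) := by
  intro p
  have hp : ContMDiffAt 𝓘(ℝ, E).tangent 𝓘(ℝ, E) ∞
      (fun p : TangentBundle 𝓘(ℝ, E) M ↦ p.1) p := contMDiffAt_proj _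
  exact ContMDiffAt.clm_apply_of_inCoordinates (F₁ := E) (E₁ := TangentSpace 𝓘(ℝ, E))
    (F₂ := E) (E₂ := TangentSpace 𝓘(ℝ, E)) (b₁ := fun p : TangentBundle 𝓘(ℝ, E) M ↦ p.1)
    (b₂ := fun p : TangentBundle 𝓘(ℝ, E) M ↦ p.1) (ϕ := fun p ↦ S p.1) (v := fun p ↦ p.2)
    (m₀ := p) ((hS p.1).comp p hp) contMDiffAt_id hp

theorem IsSmoothEndomorphism.isVectorBundleAutomorphism (hS : IsSmoothEndomorphism S)
    (hT : IsSmoothEndomorphism T) (h₁ : ∀ x, T x * S x = 1) (h₂ : ∀ x, S x * T x = 1) :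
    IsVectorBundleAutomorphism S := by
  refine ⟨⟨⟨fun p ↦ ⟨p.1, S p.1 p.2⟩, fun p ↦ ⟨p.1, T p.1 p.2⟩, fun p ↦ ?_, fun p ↦ ?_⟩,
    hS.contMDiff, hT.contMDiff⟩, fun _ _ ↦ rfl⟩
  · exact congrArg (TotalSpace.mk p.1) (congrArg (fun A ↦ A p.2) (h₁ p.1))
  · exact congrArg (TotalSpace.mk p.1) (congrArg (fun A ↦ A p.2) (h₂ p.1))

section Local

variable [FiniteDimensional ℝ E] [T2Space M]

/-- It suffices to test on global fields that are constant in the trivialization near `y`: their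
images are the columns of the local matrix. -/
theorem contMDiffAt_localEndomorphism_of_field {x y : M} (hy : y ∈ (chartAt E x).source)
    (h : ∀ W : ∀ x : M, TangentSpace 𝓘(ℝ, E) x, IsSmoothField W →
      ContMDiffAt 𝓘(ℝ, E) 𝓘(ℝ, E).tangent ∞
        (fun z ↦ (⟨z, S z (W z)⟩ : TangentBundle 𝓘(ℝ, E) M)) y) :
    ContMDiffAt 𝓘(ℝ, E) 𝓘(ℝ, E →L[ℝ] E) ∞ (localEndomorphism S x) y := by
  have hb : y ∈ (trivializationAt E (TangentSpace 𝓘(ℝ, E)) x).baseSet := hy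
  refine contMDiffAt_of_clm_apply fun w ↦ ?_
  obtain ⟨W, hW, hWw⟩ := exists_smoothField_eventuallyEq_symmL hy w
  refine ((Trivialization.contMDiffAt_section_iff _ hb).1 (h W hW)).congr_of_eventuallyEq ?_
  filter_upwards [hWw, (Trivialization.open_baseSet _).mem_nhds hb] with z hz hzb
  rw [← Trivialization.continuousLinearMapAt_apply_of_mem (R := ℝ) _ hzb, hz]
  rfl

theorem isSmoothEndomorphism_of_field (h : ∀ W : ∀ x : M, TangentSpace 𝓘(ℝ, E) x,
    IsSmoothField W → IsSmoothField fun x ↦ S x (W x)) : IsSmoothEndomorphism S :=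
  fun x ↦ contMDiffAt_localEndomorphism_of_field (mem_chart_source E x) fun W hW ↦ h W hW x

/-- The action on vector fields does not refer to a trivialization, so passing through it replaces a
computation with transition functions. -/
theorem contMDiffAt_localEndomorphism_congr {x x' y : M} (hy : y ∈ (chartAt E x).source)
    (hy' : y ∈ (chartAt E x').source)
    (h : ContMDiffAt 𝓘(ℝ, E) 𝓘(ℝ, E →L[ℝ] E) ∞ (localEndomorphism S x) y) :
    ContMDiffAt 𝓘(ℝ, E) 𝓘(ℝ, E →L[ℝ] E) ∞ (localEndomorphism S x') y := by
  have hb : y ∈ (trivializationAt E (TangentSpace 𝓘(ℝ, E)) x).baseSet := hy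
  refine contMDiffAt_localEndomorphism_of_field hy' fun W hW ↦ ?_
  refine (Trivialization.contMDiffAt_section_iff _ hb).2 ?_
  refine (h.clm_apply ((Trivialization.contMDiffAt_section_iff _ hb).1
    (hW y))).congr_of_eventuallyEq ?_
  filter_upwards [(Trivialization.open_baseSet _).mem_nhds hb] with z hz
  rw [← Trivialization.continuousLinearMapAt_apply_of_mem (R := ℝ) _ hz,
    ← Trivialization.continuousLinearMapAt_apply_of_mem (R := ℝ) _ hz,
    localEndomorphism_apply_continuousLinearMapAt hz]

theorem IsSmoothEndomorphism.contMDiffAt (hS : IsSmoothEndomorphism S) {x y : M}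
    (hy : y ∈ (chartAt E x).source) :
    ContMDiffAt 𝓘(ℝ, E) 𝓘(ℝ, E →L[ℝ] E) ∞ (localEndomorphism S x) y :=
  contMDiffAt_localEndomorphism_congr (mem_chart_source E y) hy (hS y)

end Local

theorem localEndomorphism_smul (f : M → ℝ) (x y : M) :
    localEndomorphism (fun x ↦ f x • S x) x y = f y • localEndomorphism S x y := by
  ext v
  simp [localEndomorphism]

theorem exp_conj [CompleteSpace E] (e : E ≃L[ℝ] E) (A : E →L[ℝ] E) :
    NormedSpace.exp ((e : E →L[ℝ] E) ∘L A ∘L (e.symm : E →L[ℝ] E)) =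
      (e : E →L[ℝ] E) ∘L NormedSpace.exp A ∘L (e.symm : E →L[ℝ] E) :=
  letI : NormedAlgebra ℚ (E →L[ℝ] E) := NormedAlgebra.restrictScalars ℚ ℝ _
  NormedSpace.exp_units_conj ((ContinuousLinearEquiv.unitsEquiv ℝ E).symm e) A

/-- The trivialization acts on endomorphisms by conjugation, which commutes with the exponential
series. -/
theorem localEndomorphism_exp [CompleteSpace E] {x y : M} (hy : y ∈ (chartAt E x).source) :
    localEndomorphism (fun x ↦ expEndomorphism (S x)) x y =
      NormedSpace.exp (localEndomorphism S x y) := by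
  have hb : y ∈ (trivializationAt E (TangentSpace 𝓘(ℝ, E)) x).baseSet := hy
  let e : E ≃L[ℝ] E :=
    (trivializationAt E (TangentSpace 𝓘(ℝ, E)) x).continuousLinearEquivAt ℝ y hb
  have h₁ : (e : E →L[ℝ] E) =
      (trivializationAt E (TangentSpace 𝓘(ℝ, E)) x).continuousLinearMapAt ℝ y :=
    Trivialization.coe_continuousLinearEquivAt_eq' _ hb
  have h₂ : (e.symm : E →L[ℝ] E) =
      (trivializationAt E (TangentSpace 𝓘(ℝ, E)) x).symmL ℝ y :=
    Trivialization.symm_continuousLinearEquivAt_eq' _ hb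
  have h := exp_conj e (S y)
  rw [h₁, h₂] at h
  exact h.symm

theorem expEndomorphism_add [CompleteSpace E] {x : M}
    {A B : TangentSpace 𝓘(ℝ, E) x →L[ℝ] TangentSpace 𝓘(ℝ, E) x} (h : Commute A B) :
    expEndomorphism (A + B) = expEndomorphism A * expEndomorphism B :=
  letI : NormedAlgebra ℚ (E →L[ℝ] E) := NormedAlgebra.restrictScalars ℚ ℝ _
  NormedSpace.exp_add_of_commute (𝔸 := E →L[ℝ] E) h

theorem expEndomorphism_nsmul [CompleteSpace E] {x : M} (n : ℕ)
    (A : TangentSpace 𝓘(ℝ, E) x →L[ℝ] TangentSpace 𝓘(ℝ, E) x) :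
    expEndomorphism (n • A) = expEndomorphism A ^ n :=
  letI : NormedAlgebra ℚ (E →L[ℝ] E) := NormedAlgebra.restrictScalars ℚ ℝ _
  NormedSpace.exp_nsmul (𝔸 := E →L[ℝ] E) n A

theorem expEndomorphism_zero {x : M} :
    expEndomorphism (0 : TangentSpace 𝓘(ℝ, E) x →L[ℝ] TangentSpace 𝓘(ℝ, E) x) = 1 :=
  NormedSpace.exp_zero (𝔸 := E →L[ℝ] E)

theorem contDiff_exp [CompleteSpace E] :
    ContDiff ℝ ∞ (NormedSpace.exp : (E →L[ℝ] E) → E →L[ℝ] E) :=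
  contDiff_iff_contDiffAt.2 fun A ↦ (NormedSpace.exp_analytic (𝕂 := ℝ) A).contDiffAt

theorem IsSmoothEndomorphism.exp [CompleteSpace E] (hS : IsSmoothEndomorphism S) :
    IsSmoothEndomorphism fun x ↦ expEndomorphism (S x) := by
  intro x
  refine (contDiff_exp.contDiffAt.contMDiffAt.comp x (hS x)).congr_of_eventuallyEq ?_
  filter_upwards [(chartAt E x).open_source.mem_nhds (mem_chart_source E x)] with y hy
  exact localEndomorphism_exp hy

theorem isVectorBundleAutomorphism_exp [CompleteSpace E] (hS : IsSmoothEndomorphism S) :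
    IsVectorBundleAutomorphism fun x ↦ expEndomorphism (S x) := by
  have hT : IsSmoothEndomorphism fun x ↦ - S x := by
    intro x
    refine (contDiff_neg.contDiffAt.contMDiffAt.comp x (hS x)).congr_of_eventuallyEq ?_
    refine Eventually.of_forall fun y ↦ ?_
    ext v
    simp [localEndomorphism]
  refine hS.exp.isVectorBundleAutomorphism hT.exp (fun x ↦ ?_) fun x ↦ ?_
  · rw [← expEndomorphism_add (Commute.refl (S x)).neg_left, neg_add_cancel, expEndomorphism_zero]
  · rw [← expEndomorphism_add (Commute.refl (S x)).neg_right, add_neg_cancel, expEndomorphism_zero]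

end

/-! ### From the linear factorization to automorphisms with small support -/

noncomputable section

section OfLocal

variable {E : Type*} [NormedAddCommGroup E] [NormedSpace ℝ E]
  {M : Type*} [TopologicalSpace M] [ChartedSpace E M] [IsManifold 𝓘(ℝ, E) ∞ M]

/-- The endomorphism of `T_y M` given by an endomorphism of the model space in the trivialization
of the tangent bundle at `x`. -/
def ofLocalEndomorphism (x y : M) (A : E →L[ℝ] E) :
    TangentSpace 𝓘(ℝ, E) y →L[ℝ] TangentSpace 𝓘(ℝ, E) y :=
  (trivializationAt E (TangentSpace 𝓘(ℝ, E)) x).symmL ℝ y ∘L A ∘L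
    (trivializationAt E (TangentSpace 𝓘(ℝ, E)) x).continuousLinearMapAt ℝ y

theorem ofLocalEndomorphism_apply (x y : M) (A : E →L[ℝ] E) (v : TangentSpace 𝓘(ℝ, E) y) :
    ofLocalEndomorphism x y A v = (trivializationAt E (TangentSpace 𝓘(ℝ, E)) x).symmL ℝ y
      (A ((trivializationAt E (TangentSpace 𝓘(ℝ, E)) x).continuousLinearMapAt ℝ y v)) :=
  rfl

theorem ofLocalEndomorphism_one {x y : M} (hy : y ∈ (chartAt E x).source) :
    ofLocalEndomorphism x y (1 : E →L[ℝ] E) = 1 := by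
  ext v
  exact Trivialization.symmL_continuousLinearMapAt _ hy v

theorem ofLocalEndomorphism_mul {x y : M} (hy : y ∈ (chartAt E x).source) (A B : E →L[ℝ] E) :
    ofLocalEndomorphism x y (A * B) = ofLocalEndomorphism x y A * ofLocalEndomorphism x y B := by
  ext v
  have := Trivialization.continuousLinearMapAt_symmL (R := ℝ)
    (trivializationAt E (TangentSpace 𝓘(ℝ, E)) x) hy
      (B ((trivializationAt E (TangentSpace 𝓘(ℝ, E)) x).continuousLinearMapAt ℝ y v))
  exact congrArg (fun w ↦ (trivializationAt E (TangentSpace 𝓘(ℝ, E)) x).symmL ℝ y (A w)) this.symm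

theorem ofLocalEndomorphism_sub (x y : M) (A B : E →L[ℝ] E) :
    ofLocalEndomorphism x y (A - B) = ofLocalEndomorphism x y A - ofLocalEndomorphism x y B := by
  ext v
  simp [ofLocalEndomorphism_apply]

theorem ofLocalEndomorphism_zero (x y : M) : ofLocalEndomorphism x y (0 : E →L[ℝ] E) = 0 := by
  ext v
  simp [ofLocalEndomorphism_apply]

theorem ofLocalEndomorphism_sub_one_sq {x y : M} (hy : y ∈ (chartAt E x).source) {A : E →L[ℝ] E}
    (h : (A - 1) ^ 2 = 0) : (ofLocalEndomorphism x y A - 1) ^ 2 = 0 := by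
  rw [← ofLocalEndomorphism_one hy, ← ofLocalEndomorphism_sub, sq, ← ofLocalEndomorphism_mul hy,
    ← sq, h, ofLocalEndomorphism_zero]

theorem ofLocalEndomorphism_list_prod {x y : M} (hy : y ∈ (chartAt E x).source)
    (l : List (E →L[ℝ] E)) :
    ofLocalEndomorphism x y l.prod = (l.map (ofLocalEndomorphism x y)).prod := by
  induction l with
  | nil => exact ofLocalEndomorphism_one hy
  | cons A l ih => rw [List.prod_cons, ofLocalEndomorphism_mul hy, ih, List.map_cons,
      List.prod_cons]

theorem ofLocalEndomorphism_localEndomorphism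
    {S : ∀ x : M, TangentSpace 𝓘(ℝ, E) x →L[ℝ] TangentSpace 𝓘(ℝ, E) x} {x y : M}
    (hy : y ∈ (chartAt E x).source) :
    ofLocalEndomorphism x y (localEndomorphism S x y) = S y := by
  ext v
  rw [ofLocalEndomorphism_apply, symmL_localEndomorphism hy,
    Trivialization.symmL_continuousLinearMapAt _ hy]

theorem localEndomorphism_eq_of_eq
    {S : ∀ x : M, TangentSpace 𝓘(ℝ, E) x →L[ℝ] TangentSpace 𝓘(ℝ, E) x} {x y : M}
    (hy : y ∈ (chartAt E x).source) {A : E →L[ℝ] E} (h : S y = ofLocalEndomorphism x y A) :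
    localEndomorphism S x y = A := by
  ext v
  simp only [localEndomorphism, h, ContinuousLinearMap.comp_apply, ofLocalEndomorphism_apply]
  rw [Trivialization.continuousLinearMapAt_symmL _ hy,
    Trivialization.continuousLinearMapAt_symmL _ hy]

theorem localEndomorphism_eq_one
    {S : ∀ x : M, TangentSpace 𝓘(ℝ, E) x →L[ℝ] TangentSpace 𝓘(ℝ, E) x} {x y : M}
    (hy : y ∈ (chartAt E x).source) (h : S y = 1) : localEndomorphism S x y = 1 :=
  localEndomorphism_eq_of_eq hy (h.trans (ofLocalEndomorphism_one hy).symm)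

/-- If `(S - 1) ^ 2 = 0`, the inverse of `S` is `2 - S`, which is again smooth. -/
theorem IsSmoothEndomorphism.isVectorBundleAutomorphism_of_sq
    {S : ∀ x : M, TangentSpace 𝓘(ℝ, E) x →L[ℝ] TangentSpace 𝓘(ℝ, E) x}
    (hS : IsSmoothEndomorphism S) (h : ∀ x, (S x - 1) ^ 2 = 0) :
    IsVectorBundleAutomorphism S := by
  have hT : IsSmoothEndomorphism fun x ↦ 2 • 1 - S x := by
    intro x
    refine ((contDiff_const (c := 2 • (1 : E →L[ℝ] E))).sub
      contDiff_id).contDiffAt.contMDiffAt.comp x (hS x) |>.congr_of_eventuallyEq ?_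
    filter_upwards [(chartAt E x).open_source.mem_nhds (mem_chart_source E x)] with y hy
    refine localEndomorphism_eq_of_eq hy ?_
    simp only [Function.comp, id, ofLocalEndomorphism_sub,
      ofLocalEndomorphism_localEndomorphism hy, two_smul]
    rw [← ofLocalEndomorphism_one hy]
    congr 1
    ext v
    simp [ofLocalEndomorphism_apply]
  refine hS.isVectorBundleAutomorphism hT (fun x ↦ ?_) fun x ↦ ?_
  · rw [← sub_eq_zero, ← neg_eq_zero, ← h x]
    noncomm_ring
  · rw [← sub_eq_zero, ← neg_eq_zero, ← h x]
    noncomm_ring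

end OfLocal

variable {E : Type*} [NormedAddCommGroup E] [NormedSpace ℝ E] [FiniteDimensional ℝ E]
  {M : Type*} [TopologicalSpace M] [ChartedSpace E M] [IsManifold 𝓘(ℝ, E) ∞ M]
  [RiemannianBundle (fun x : M ↦ TangentSpace 𝓘(ℝ, E) x)]
  [IsContMDiffRiemannianBundle 𝓘(ℝ, E) ∞ E (fun x : M ↦ TangentSpace 𝓘(ℝ, E) x)]
  {J S A : ∀ x : M, TangentSpace 𝓘(ℝ, E) x →L[ℝ] TangentSpace 𝓘(ℝ, E) x}

/-- The unipotent automorphisms of the tangent bundle that preserve the form `⟨J u, v⟩`. -/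
def unipotentAutomorphisms (J : ∀ x : M, TangentSpace 𝓘(ℝ, E) x →L[ℝ] TangentSpace 𝓘(ℝ, E) x) :
    Set (∀ x : M, TangentSpace 𝓘(ℝ, E) x →L[ℝ] TangentSpace 𝓘(ℝ, E) x) :=
  {S | (IsVectorBundleAutomorphism S ∧
    ∀ (x : M) (u v : TangentSpace 𝓘(ℝ, E) x), inner ℝ (J x (S x u)) (S x v) = inner ℝ (J x u) v) ∧
    IsUnipotentOnFibers S}

theorem preserves_localEndomorphism {x y : M} (hy : y ∈ (chartAt E x).source)
    (h : ∀ u v : TangentSpace 𝓘(ℝ, E) y, inner ℝ (J y (S y u)) (S y v) = inner ℝ (J y u) v) :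
    SymplecticForm.Preserves (localForm J x y) (localEndomorphism S x y) := by
  intro u v
  rw [localForm_apply, localForm_apply, symmL_localEndomorphism hy, symmL_localEndomorphism hy, h]

theorem inner_ofLocalEndomorphism {x y : M} (hy : y ∈ (chartAt E x).source) {B : E →L[ℝ] E}
    (h : SymplecticForm.Preserves (localForm J x y) B) (u v : TangentSpace 𝓘(ℝ, E) y) :
    inner ℝ (J y (ofLocalEndomorphism x y B u)) (ofLocalEndomorphism x y B v) =
      inner ℝ (J y u) v := by
  have := h ((trivializationAt E (TangentSpace 𝓘(ℝ, E)) x).continuousLinearMapAt ℝ y u)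
    ((trivializationAt E (TangentSpace 𝓘(ℝ, E)) x).continuousLinearMapAt ℝ y v)
  rw [localForm_apply, localForm_apply, Trivialization.symmL_continuousLinearMapAt _ hy,
    Trivialization.symmL_continuousLinearMapAt _ hy] at this
  exact this

theorem inner_expEndomorphism
    (hA : ∀ (x : M) (u v : TangentSpace 𝓘(ℝ, E) x),
      inner ℝ (J x (A x u)) v = - inner ℝ (J x u) (A x v)) (x : M)
    (u v : TangentSpace 𝓘(ℝ, E) x) :
    inner ℝ (J x (expEndomorphism (A x) u)) (expEndomorphism (A x) v) = inner ℝ (J x u) v := by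
  have := FiniteDimensional.complete ℝ E
  have hx := mem_chart_source E x
  have h : SymplecticForm.Preserves (localForm J x x)
      (localEndomorphism (fun x ↦ expEndomorphism (A x)) x x) := by
    rw [localEndomorphism_exp hx]
    refine SymplecticForm.preserves_exp fun u v ↦ ?_
    rw [localForm_apply, localForm_apply, symmL_localEndomorphism hx, symmL_localEndomorphism hx,
      hA]
  have := inner_ofLocalEndomorphism hx h u v
  rwa [ofLocalEndomorphism_localEndomorphism hx] at this

variable [T2Space M]

/-- The linear factorization is applied in each fibre over `O` to the local form and the local
matrix of `S`. Its factors equal `1` wherever `S` does, in particular off the closed set `C ⊆ O`, so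
they extend smoothly by the identity. Both `O` and `W` are independent of `S`. -/
theorem exists_mem_closure_unipotentAutomorphisms
    (hJ : ∀ W : ∀ x : M, TangentSpace 𝓘(ℝ, E) x, IsSmoothField W →
      IsSmoothField fun x ↦ J x (W x))
    (hJ0 : ∀ (x : M) (u : TangentSpace 𝓘(ℝ, E) x), J x u = 0 → u = 0)
    (hJa : ∀ (x : M) (u : TangentSpace 𝓘(ℝ, E) x), inner ℝ (J x u) u = 0) (x : M) :
    ∃ O : Set M, IsOpen O ∧ x ∈ O ∧ O ⊆ (chartAt E x).source ∧ ∃ W ∈ 𝓝 (1 : E →L[ℝ] E),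
      ∀ S : ∀ x : M, TangentSpace 𝓘(ℝ, E) x →L[ℝ] TangentSpace 𝓘(ℝ, E) x,
        IsSmoothEndomorphism S →
        (∀ (x : M) (u v : TangentSpace 𝓘(ℝ, E) x),
          inner ℝ (J x (S x u)) (S x v) = inner ℝ (J x u) v) →
        ∀ C : Set M, IsClosed C → C ⊆ O → (∀ y ∉ C, S y = 1) →
          (∀ y ∈ O, localEndomorphism S x y ∈ W) →
          S ∈ Submonoid.closure (unipotentAutomorphisms J) := by
  classical
  obtain ⟨L, hL, hev⟩ := SymplecticForm.exists_unipotent_factorization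
    (isInvertible_localForm (hJ0 x) (mem_chart_source E x))
  rw [nhds_prod_eq] at hev
  obtain ⟨W₁, hW₁, W₂, hW₂, hW⟩ := Filter.mem_prod_iff.1 hev
  have hO := inter_mem
    (mem_map.1 ((contMDiffAt_localForm hJ (mem_chart_source E x)).continuousAt hW₁))
    ((chartAt E x).open_source.mem_nhds (mem_chart_source E x))
  obtain ⟨O, hOs, hOo, hxO⟩ := mem_nhds_iff.1 hO
  refine ⟨O, hOo, hxO, fun y hy ↦ (hOs hy).2, W₂, hW₂, fun S hS hSJ C hC hCO hSC hSW ↦ ?_⟩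
  have halt (y : M) (u : E) : localForm J x y u u = 0 := by rw [localForm_apply, hJa]
  let T (F : (E →L[ℝ] E →L[ℝ] ℝ) × (E →L[ℝ] E) → E →L[ℝ] E) (y : M) :
      TangentSpace 𝓘(ℝ, E) y →L[ℝ] TangentSpace 𝓘(ℝ, E) y :=
    if y ∈ O then ofLocalEndomorphism x y (F (localForm J x y, localEndomorphism S x y)) else 1
  have hTO (F : (E →L[ℝ] E →L[ℝ] ℝ) × (E →L[ℝ] E) → E →L[ℝ] E) (y : M) (hy : y ∈ O) :
      T F y = ofLocalEndomorphism x y (F (localForm J x y, localEndomorphism S x y)) := if_pos hy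
  have hTO' (F : (E →L[ℝ] E →L[ℝ] ℝ) × (E →L[ℝ] E) → E →L[ℝ] E) (y : M) (hy : y ∉ O) :
      T F y = 1 := if_neg hy
  have hloc (y : M) (hy : y ∈ O) := hW (show (localForm J x y, localEndomorphism S x y) ∈ W₁ ×ˢ W₂
    from ⟨(hOs hy).1, hSW y hy⟩)
  have hLF (F) (hF : F ∈ L) (y : M) :=
    hL F hF (localForm J x y, localEndomorphism S x y) (halt y)
  have hTC (F) (hF : F ∈ L) (y : M) (hy : y ∉ C) : T F y = 1 := by
    by_cases hyO : y ∈ O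
    · rw [hTO F y hyO, localEndomorphism_eq_one (hOs hyO).2 (hSC y hy),
        ((hloc y hyO).1 F hF).2, ofLocalEndomorphism_one (hOs hyO).2]
    · exact hTO' F y hyO
  have hsmooth (F) (hF : F ∈ L) : IsSmoothEndomorphism (T F) := by
    intro y
    by_cases hyO : y ∈ O
    · refine contMDiffAt_localEndomorphism_congr (hOs hyO).2 (mem_chart_source E y) ?_
      have h₁ : ContMDiffAt 𝓘(ℝ, E) 𝓘(ℝ, (E →L[ℝ] E →L[ℝ] ℝ) × (E →L[ℝ] E)) ∞
          (fun z ↦ (localForm J x z, localEndomorphism S x z)) y :=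
        (contMDiffAt_localForm hJ (hOs hyO).2).prodMk_space (hS.contMDiffAt (hOs hyO).2)
      refine (((hloc y hyO).1 F hF).1.contMDiffAt.comp y h₁).congr_of_eventuallyEq ?_
      filter_upwards [hOo.mem_nhds hyO] with z hz
      exact localEndomorphism_eq_of_eq (hOs hz).2 (hTO F z hz)
    -- A point outside `O` has the complement of `C` as a neighbourhood, and there the factor is
    -- constantly `1`, even at points of `O`.
    · refine (contMDiffAt_const (c := (1 : E →L[ℝ] E))).congr_of_eventuallyEq ?_
      filter_upwards [hC.isOpen_compl.mem_nhds fun h ↦ hyO (hCO h),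
        (chartAt E y).open_source.mem_nhds (mem_chart_source E y)] with z hz hz'
      exact localEndomorphism_eq_one hz' (hTC F hF z hz)
  have hsq (F) (hF : F ∈ L) (y : M) : (T F y - 1) ^ 2 = 0 := by
    by_cases hyO : y ∈ O
    · rw [hTO F y hyO]
      exact ofLocalEndomorphism_sub_one_sq (hOs hyO).2 (hLF F hF y).2
    · rw [hTO' F y hyO, sub_self, zero_pow two_ne_zero]
  have hprod : S = (L.map T).prod := by
    funext y
    have e : (L.map T).prod y = (L.map fun F ↦ T F y).prod := by
      rw [Pi.list_prod_apply, List.map_map]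
      rfl
    rw [e]
    by_cases hyO : y ∈ O
    · have h : (L.map fun F ↦ F (localForm J x y, localEndomorphism S x y)).prod =
          localEndomorphism S x y :=
        (hloc y hyO).2 (halt y) (preserves_localEndomorphism (hOs hyO).2 (hSJ y))
      rw [← ofLocalEndomorphism_localEndomorphism (S := S) (hOs hyO).2, ← h,
        ofLocalEndomorphism_list_prod (hOs hyO).2, List.map_map]
      exact congrArg List.prod (List.map_congr_left fun F _ ↦ (hTO F y hyO).symm)
    · rw [hSC y fun h ↦ hyO (hCO h), List.prod_map_eq_one fun F _ ↦ hTO' F y hyO]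
  rw [hprod]
  refine Submonoid.list_prod_mem _ fun B hB ↦ Submonoid.subset_closure ?_
  obtain ⟨F, hF, rfl⟩ := List.mem_map.1 hB
  refine ⟨⟨(hsmooth F hF).isVectorBundleAutomorphism_of_sq (hsq F hF), fun y u v ↦ ?_⟩,
    fun y ↦ ⟨2, hsq F hF y⟩⟩
  by_cases hyO : y ∈ O
  · rw [hTO F y hyO, inner_ofLocalEndomorphism (hOs hyO).2 (hLF F hF y).1]
  · rw [hTO' F y hyO]
    rfl

end

/-! ### Globalization by a partition of unity -/

noncomputable section

theorem IsSmoothEndomorphism.smul {E : Type*} [NormedAddCommGroup E] [NormedSpace ℝ E]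
    {M : Type*} [TopologicalSpace M] [ChartedSpace E M] [IsManifold 𝓘(ℝ, E) ∞ M]
    {A : ∀ x : M, TangentSpace 𝓘(ℝ, E) x →L[ℝ] TangentSpace 𝓘(ℝ, E) x}
    (hA : IsSmoothEndomorphism A) {f : M → ℝ} (hf : ContMDiff 𝓘(ℝ, E) 𝓘(ℝ) ∞ f) :
    IsSmoothEndomorphism fun x ↦ f x • A x := by
  intro x
  refine ((hf x).smul (hA x)).congr_of_eventuallyEq (Eventually.of_forall fun y ↦ ?_)
  exact localEndomorphism_smul f x y

variable {E : Type*} [NormedAddCommGroup E] [NormedSpace ℝ E] [FiniteDimensional ℝ E]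
  {M : Type*} [TopologicalSpace M] [ChartedSpace E M] [IsManifold 𝓘(ℝ, E) ∞ M]
  [RiemannianBundle (fun x : M ↦ TangentSpace 𝓘(ℝ, E) x)]
  [IsContMDiffRiemannianBundle 𝓘(ℝ, E) ∞ E (fun x : M ↦ TangentSpace 𝓘(ℝ, E) x)]
  {J A : ∀ x : M, TangentSpace 𝓘(ℝ, E) x →L[ℝ] TangentSpace 𝓘(ℝ, E) x}
  [T2Space M] [CompactSpace M]

theorem exists_forall_exp_inv_smul_mem [CompleteSpace E] {W : Set (E →L[ℝ] E)}
    (hW : W ∈ 𝓝 1) (R : ℝ) :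
    ∃ K : ℕ, K ≠ 0 ∧ ∀ B : E →L[ℝ] E, ‖B‖ ≤ R → NormedSpace.exp ((K : ℝ)⁻¹ • B) ∈ W := by
  have hc : ContinuousAt (NormedSpace.exp : (E →L[ℝ] E) → E →L[ℝ] E) 0 :=
    contDiff_exp.continuous.continuousAt
  rw [ContinuousAt, NormedSpace.exp_zero] at hc
  obtain ⟨δ, hδ, h⟩ := Metric.mem_nhds_iff.1 (hc hW)
  obtain ⟨K, hK⟩ := exists_nat_gt (max 0 (R / δ))
  have hK0 : (0 : ℝ) < K := (le_max_left _ _).trans_lt hK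
  refine ⟨K, fun h ↦ by simp [h] at hK0, fun B hB ↦ h ?_⟩
  rw [mem_ball_zero_iff, norm_smul, norm_inv, Real.norm_of_nonneg hK0.le, inv_mul_lt_iff₀ hK0]
  exact hB.trans_lt ((div_lt_iff₀ hδ).1 ((le_max_right _ _).trans_lt hK))

/-- On a compact manifold, the exponential of a field of endomorphisms that are infinitesimally
symplectic for a nondegenerate form is a product of unipotent symplectic automorphisms. -/
theorem expEndomorphism_mem_closure_unipotentAutomorphisms
    (hJ : ∀ W : ∀ x : M, TangentSpace 𝓘(ℝ, E) x, IsSmoothField W →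
      IsSmoothField fun x ↦ J x (W x))
    (hJ0 : ∀ (x : M) (u : TangentSpace 𝓘(ℝ, E) x), J x u = 0 → u = 0)
    (hJa : ∀ (x : M) (u : TangentSpace 𝓘(ℝ, E) x), inner ℝ (J x u) u = 0)
    (hA : IsSmoothEndomorphism A)
    (hAJ : ∀ (x : M) (u v : TangentSpace 𝓘(ℝ, E) x),
      inner ℝ (J x (A x u)) v = - inner ℝ (J x u) (A x v)) :
    (fun x ↦ expEndomorphism (A x)) ∈ Submonoid.closure (unipotentAutomorphisms J) := by
  classical
  have := FiniteDimensional.complete ℝ E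
  choose O hO hxO hOs W hW hOW using exists_mem_closure_unipotentAutomorphisms hJ hJ0 hJa
  obtain ⟨ρ, hρ⟩ := SmoothPartitionOfUnity.exists_isSubordinate 𝓘(ℝ, E) (isClosed_univ (X := M))
    O hO fun x _ ↦ Set.mem_iUnion.2 ⟨x, hxO x⟩
  have hmem (i : M) : (fun x ↦ expEndomorphism (ρ i x • A x)) ∈
      Submonoid.closure (unipotentAutomorphisms J) := by
    -- Closeness to `1` has to be uniform in the base point. The support of `ρ i` is compact and
    -- lies in the chart domain, so the local matrix of `ρ i • A` is bounded on it.
    obtain ⟨R, hR⟩ : ∃ R, ∀ y ∈ tsupport (ρ i), ‖ρ i y • localEndomorphism A i y‖ ≤ R :=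
      (isClosed_tsupport _).isCompact.exists_bound_of_continuousOn fun y hy ↦
        ((ρ i).contMDiff.continuous.continuousAt.smul
          (hA.contMDiffAt (hOs i (hρ i hy))).continuousAt).continuousWithinAt
    obtain ⟨K, hK, hKW⟩ := exists_forall_exp_inv_smul_mem (hW i) (max 0 R)
    have e : (fun x ↦ expEndomorphism (ρ i x • A x)) =
        (fun x ↦ expEndomorphism (((K : ℝ)⁻¹ * ρ i x) • A x)) ^ K := by
      funext x
      rw [Pi.pow_apply, ← expEndomorphism_nsmul, mul_smul, ← Nat.cast_smul_eq_nsmul ℝ, smul_smul,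
        mul_inv_cancel₀ (Nat.cast_ne_zero.2 hK), one_smul]
    have h0 (y : M) (hy : y ∉ tsupport (ρ i)) : ρ i y = 0 := image_eq_zero_of_notMem_tsupport hy
    have hf : ContMDiff 𝓘(ℝ, E) 𝓘(ℝ) ∞ fun x ↦ (K : ℝ)⁻¹ * ρ i x :=
      contMDiff_const.mul (ρ i).contMDiff
    rw [e]
    refine Submonoid.pow_mem _ (hOW i _ (hA.smul hf).exp
      (inner_expEndomorphism fun x u v ↦ ?_) (tsupport (ρ i)) (isClosed_tsupport _) (hρ i)
      (fun y hy ↦ ?_) fun y hy ↦ ?_) K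
    · have := hAJ x u v
      simp only [smul_apply, map_smul, real_inner_smul_left,
        real_inner_smul_right, this]
      ring
    · rw [h0 y hy, mul_zero, zero_smul, expEndomorphism_zero]
    · rw [localEndomorphism_exp (hOs i hy), localEndomorphism_smul, mul_smul]
      refine hKW _ ?_
      by_cases hy' : y ∈ tsupport (ρ i)
      · exact (hR y hy').trans (le_max_right _ _)
      · rw [h0 y hy', zero_smul, norm_zero]
        exact le_max_left _ _
  have hfin := ρ.locallyFinite.finite_nonempty_of_compact
  have hsum (x : M) : ∑ i ∈ hfin.toFinset, ρ i x = 1 := by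
    rw [← ρ.sum_eq_one (Set.mem_univ x)]
    refine (finsum_eq_sum_of_support_subset _ fun i hi ↦ ?_).symm
    exact Finset.mem_coe.2 (hfin.mem_toFinset.2 ⟨x, hi⟩)
  -- Scalar multiples of the same `A x` commute, so the exponential turns the partial sums of the
  -- partition into products.
  have hind (s : Finset M) : (fun x ↦ expEndomorphism ((∑ i ∈ s, ρ i x) • A x)) ∈
      Submonoid.closure (unipotentAutomorphisms J) := by
    induction s using Finset.induction_on with
    | empty =>
      simp only [Finset.sum_empty, zero_smul, expEndomorphism_zero]
      exact Submonoid.one_mem _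
    | insert i s hi ih =>
      have e : (fun x ↦ expEndomorphism ((∑ i ∈ insert i s, ρ i x) • A x)) =
          (fun x ↦ expEndomorphism (ρ i x • A x)) *
            fun x ↦ expEndomorphism ((∑ i ∈ s, ρ i x) • A x) := by
        funext x
        rw [Pi.mul_apply, Finset.sum_insert hi, add_smul]
        exact expEndomorphism_add (((Commute.refl (A x)).smul_left _).smul_right _)
      rw [e]
      exact Submonoid.mul_mem _ (hmem i) ih
  simpa only [hsum, one_smul] using hind hfin.toFinset

end

/-! ### Integrability: coordinate fields and the Nijenhuis tensor -/

noncomputable section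

theorem lieBracketWithin_univ_eq_zero {E : Type*} [NormedAddCommGroup E] [NormedSpace ℝ E]
    {f g : E → E} {x v w : E} (hf : f =ᶠ[𝓝 x] fun _ ↦ v) (hg : g =ᶠ[𝓝 x] fun _ ↦ w) :
    VectorField.lieBracketWithin ℝ f g Set.univ x = 0 := by
  rw [VectorField.lieBracketWithin_univ, hf.lieBracket_vectorField_eq hg, VectorField.lieBracket]
  simp

variable {E : Type*} [NormedAddCommGroup E] [NormedSpace ℝ E]
  {M : Type*} [TopologicalSpace M] [ChartedSpace E M] [IsManifold 𝓘(ℝ, E) ∞ M]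
  {J : ∀ x : M, TangentSpace 𝓘(ℝ, E) x →L[ℝ] TangentSpace 𝓘(ℝ, E) x}
  {Y Z : ∀ x : M, TangentSpace 𝓘(ℝ, E) x}

/-- Coordinate fields commute. -/
theorem mlieBracket_symmL_eq_zero (x : M) (v w : E) :
    VectorField.mlieBracket 𝓘(ℝ, E)
      (fun y ↦ (trivializationAt E (TangentSpace 𝓘(ℝ, E)) x).symmL ℝ y v)
      (fun y ↦ (trivializationAt E (TangentSpace 𝓘(ℝ, E)) x).symmL ℝ y w) x = 0 := by
  -- Pulled back to the chart at `x`, a field that is constant in the trivialization at `x` becomes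
  -- the constant field `v`.
  have h (v : E) : VectorField.mpullbackWithin 𝓘(ℝ, E) 𝓘(ℝ, E) (extChartAt 𝓘(ℝ, E) x).symm
      (fun y ↦ (trivializationAt E (TangentSpace 𝓘(ℝ, E)) x).symmL ℝ y v) (Set.range 𝓘(ℝ, E))
      =ᶠ[𝓝 (extChartAt 𝓘(ℝ, E) x x)] fun _ ↦ v := by
    filter_upwards [extChartAt_target_mem_nhds (I := 𝓘(ℝ, E)) x] with z hz
    have hz' : (extChartAt 𝓘(ℝ, E) x).symm z ∈ (chartAt E x).source := by
      rw [← extChartAt_source 𝓘(ℝ, E)]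
      exact (extChartAt 𝓘(ℝ, E) x).map_target hz
    rw [VectorField.mpullbackWithin_apply, TangentBundle.symmL_trivializationAt hz',
      (extChartAt 𝓘(ℝ, E) x).right_inv hz]
    exact (isInvertible_mfderivWithin_extChartAt_symm hz).inverse_apply_self _
  rw [← VectorField.mlieBracketWithin_univ, VectorField.mlieBracketWithin_apply]
  simp only [Set.preimage_univ, Set.univ_inter]
  have hr : Set.range 𝓘(ℝ, E) = Set.univ := ModelWithCorners.range_eq_univ _
  rw [hr] at h ⊢
  exact (congrArg _ (lieBracketWithin_univ_eq_zero (h v) (h w))).trans (map_zero _)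

theorem IsSmoothEndomorphism.isSmoothField (hJ : IsSmoothEndomorphism J) (hY : IsSmoothField Y) :
    IsSmoothField fun x ↦ J x (Y x) :=
  hJ.contMDiff.comp hY

theorem IsSmoothEndomorphism.mdifferentiableAt (hJ : IsSmoothEndomorphism J) {x : M}
    (hY : MDiffAt (T% Y) x) : MDiffAt (T% (fun x ↦ J x (Y x))) x :=
  MDifferentiableAt.comp (I' := 𝓘(ℝ, E).tangent) x
    ((hJ.contMDiff ⟨x, Y x⟩).mdifferentiableAt (by simp)) hY

/-- The Nijenhuis tensor of an almost complex structure. -/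
def nijenhuis (J : ∀ x : M, TangentSpace 𝓘(ℝ, E) x →L[ℝ] TangentSpace 𝓘(ℝ, E) x)
    (Y Z : ∀ x : M, TangentSpace 𝓘(ℝ, E) x) (x : M) : TangentSpace 𝓘(ℝ, E) x :=
  VectorField.mlieBracket 𝓘(ℝ, E) (fun y ↦ J y (Y y)) (fun y ↦ J y (Z y)) x
    - J x (VectorField.mlieBracket 𝓘(ℝ, E) (fun y ↦ J y (Y y)) Z x)
    - J x (VectorField.mlieBracket 𝓘(ℝ, E) Y (fun y ↦ J y (Z y)) x)
    - VectorField.mlieBracket 𝓘(ℝ, E) Y Z x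

theorem nijenhuis_swap (x : M) : nijenhuis J Y Z x = - nijenhuis J Z Y x := by
  simp only [nijenhuis]
  rw [VectorField.mlieBracket_swap_apply (V := Y) (W := Z),
    VectorField.mlieBracket_swap_apply (V := Y) (W := fun y ↦ J y (Z y)),
    VectorField.mlieBracket_swap_apply (V := fun y ↦ J y (Y y)) (W := Z),
    VectorField.mlieBracket_swap_apply (V := fun y ↦ J y (Y y))
      (W := fun y ↦ J y (Z y)), map_neg, map_neg]
  abel

/-- The terms that differentiate `f` along `J Z` cancel directly; those that differentiate it along
`Z` cancel because `J² = -1`. -/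
theorem nijenhuis_tensorial_left [CompleteSpace E] (hJ : IsSmoothEndomorphism J)
    (hJ2 : ∀ (x : M) (v : TangentSpace 𝓘(ℝ, E) x), J x (J x v) = -v) (x : M) :
    TensorialAt 𝓘(ℝ, E) E (fun Y ↦ nijenhuis J Y Z x) x := by
  constructor
  · intro f Y hf hY
    have e : (fun y ↦ J y ((f • Y) y)) = f • fun y ↦ J y (Y y) := by
      funext y
      exact map_smul (J y) (f y) (Y y)
    simp only [nijenhuis, e, VectorField.mlieBracket_smul_left hf hY,
      VectorField.mlieBracket_smul_left hf (hJ.mdifferentiableAt hY), map_add,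
      map_smul, hJ2]
    module
  · intro Y Y' hY hY'
    have e : (fun y ↦ J y ((Y + Y') y)) = (fun y ↦ J y (Y y)) + fun y ↦ J y (Y' y) := by
      funext y
      exact map_add (J y) (Y y) (Y' y)
    simp only [nijenhuis, e, VectorField.mlieBracket_add_left hY hY',
      VectorField.mlieBracket_add_left (hJ.mdifferentiableAt hY) (hJ.mdifferentiableAt hY'),
      map_add]
    abel

theorem nijenhuis_tensorial_right [CompleteSpace E] (hJ : IsSmoothEndomorphism J)
    (hJ2 : ∀ (x : M) (v : TangentSpace 𝓘(ℝ, E) x), J x (J x v) = -v) (x : M) :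
    TensorialAt 𝓘(ℝ, E) E (fun Z ↦ nijenhuis J Y Z x) x := by
  have h := nijenhuis_tensorial_left (Z := Y) hJ hJ2 x
  constructor
  · intro f Z hf hZ
    have := h.smul hf hZ
    simp only [nijenhuis_swap (Y := Y), this, smul_neg]
  · intro Z Z' hZ hZ'
    have := h.add hZ hZ'
    simp only [nijenhuis_swap (Y := Y), this, neg_add]

/-- An almost complex structure that is constant in suitable charts is integrable. -/
theorem nijenhuis_eq_zero [FiniteDimensional ℝ E] [T2Space M] (hJ : IsSmoothEndomorphism J)
    (hJ2 : ∀ (x : M) (v : TangentSpace 𝓘(ℝ, E) x), J x (J x v) = -v) {x : M}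
    {J₀ : E → E} (hJ₀ : ∀ y ∈ (chartAt E x).source, ∀ v : E,
      J y ((trivializationAt E (TangentSpace 𝓘(ℝ, E)) x).symmL ℝ y v) =
        (trivializationAt E (TangentSpace 𝓘(ℝ, E)) x).symmL ℝ y (J₀ v))
    (hY : MDiffAt (T% Y) x) (hZ : MDiffAt (T% Z) x) : nijenhuis J Y Z x = 0 := by
  have := FiniteDimensional.complete ℝ E
  have hx := mem_chart_source E x
  obtain ⟨v, hv⟩ : ∃ v, (trivializationAt E (TangentSpace 𝓘(ℝ, E)) x).symmL ℝ x v = Y x :=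
    ⟨_, Trivialization.symmL_continuousLinearMapAt _ hx (Y x)⟩
  obtain ⟨w, hw⟩ : ∃ w, (trivializationAt E (TangentSpace 𝓘(ℝ, E)) x).symmL ℝ x w = Z x :=
    ⟨_, Trivialization.symmL_continuousLinearMapAt _ hx (Z x)⟩
  obtain ⟨Y', hY', hYv⟩ := exists_smoothField_eventuallyEq_symmL hx v
  obtain ⟨Z', hZ', hZw⟩ := exists_smoothField_eventuallyEq_symmL hx w
  -- By tensoriality both fields may be replaced by coordinate fields. As `J` has constant
  -- coefficients, it maps these to coordinate fields, and all four brackets vanish.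
  have e := TensorialAt.pointwise₂ (Φ := fun Y Z ↦ nijenhuis J Y Z x)
    (fun _ _ ↦ nijenhuis_tensorial_left hJ hJ2 x) (fun _ _ ↦ nijenhuis_tensorial_right hJ hJ2 x)
    hY (hY'.mdifferentiableAt x) hZ (hZ'.mdifferentiableAt x)
    (hv.symm.trans hYv.self_of_nhds.symm) (hw.symm.trans hZw.self_of_nhds.symm)
  have hJW {W : ∀ x : M, TangentSpace 𝓘(ℝ, E) x} {u : E} (h : ∀ᶠ z in 𝓝 x,
      W z = (trivializationAt E (TangentSpace 𝓘(ℝ, E)) x).symmL ℝ z u) :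
      (fun y ↦ J y (W y)) =ᶠ[𝓝 x]
        fun y ↦ (trivializationAt E (TangentSpace 𝓘(ℝ, E)) x).symmL ℝ y (J₀ u) := by
    filter_upwards [h, (chartAt E x).open_source.mem_nhds hx] with y hy hys
    rw [← hJ₀ y hys, hy]
  have h0 {W W' : ∀ x : M, TangentSpace 𝓘(ℝ, E) x} {u u' : E}
      (h : W =ᶠ[𝓝 x] fun y ↦ (trivializationAt E (TangentSpace 𝓘(ℝ, E)) x).symmL ℝ y u)
      (h' : W' =ᶠ[𝓝 x] fun y ↦ (trivializationAt E (TangentSpace 𝓘(ℝ, E)) x).symmL ℝ y u') :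
      VectorField.mlieBracket 𝓘(ℝ, E) W W' x = 0 := by
    rw [h.mlieBracket_vectorField_eq h', mlieBracket_symmL_eq_zero]
  rw [e]
  simp only [nijenhuis]
  rw [h0 (hJW hYv) (hJW hZw), h0 (hJW hYv) hZw, h0 hYv (hJW hZw), h0 hYv hZw]
  simp

end

/-! ### The parallel complex structure and the symmetries of the curvature -/

noncomputable section

variable {E : Type*} [NormedAddCommGroup E] [NormedSpace ℝ E] [FiniteDimensional ℝ E]
  {M : Type*} [TopologicalSpace M] [ChartedSpace E M] [IsManifold 𝓘(ℝ, E) ∞ M]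
  [RiemannianBundle (fun x : M ↦ TangentSpace 𝓘(ℝ, E) x)]
  [IsContMDiffRiemannianBundle 𝓘(ℝ, E) ∞ E (fun x : M ↦ TangentSpace 𝓘(ℝ, E) x)]
  {J : ∀ x : M, TangentSpace 𝓘(ℝ, E) x →L[ℝ] TangentSpace 𝓘(ℝ, E) x}
  {X Y Z U V W : ∀ x : M, TangentSpace 𝓘(ℝ, E) x}

/-- The exterior derivative of the form `⟨J u, v⟩`. -/
def extDerivForm (J : ∀ x : M, TangentSpace 𝓘(ℝ, E) x →L[ℝ] TangentSpace 𝓘(ℝ, E) x)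
    (X Y Z : ∀ x : M, TangentSpace 𝓘(ℝ, E) x) (x : M) : ℝ :=
  mvfderiv 𝓘(ℝ, E) (fun y ↦ inner ℝ (J y (Y y)) (Z y)) x (X x)
    - mvfderiv 𝓘(ℝ, E) (fun y ↦ inner ℝ (J y (X y)) (Z y)) x (Y x)
    + mvfderiv 𝓘(ℝ, E) (fun y ↦ inner ℝ (J y (X y)) (Y y)) x (Z x)
    - inner ℝ (J x (VectorField.mlieBracket 𝓘(ℝ, E) X Y x)) (Z x)
    + inner ℝ (J x (VectorField.mlieBracket 𝓘(ℝ, E) X Z x)) (Y x)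
    - inner ℝ (J x (VectorField.mlieBracket 𝓘(ℝ, E) Y Z x)) (X x)

theorem mvfderiv_fun_neg (f : M → ℝ) (x : M) (v : TangentSpace 𝓘(ℝ, E) x) :
    mvfderiv 𝓘(ℝ, E) (fun y ↦ - f y) x v = - mvfderiv 𝓘(ℝ, E) f x v := by
  have : mvfderiv 𝓘(ℝ, E) (fun y ↦ - f y) x = - mvfderiv 𝓘(ℝ, E) f x := mvfderiv_neg ..
  rw [this]
  rfl

/-- By the Koszul formula and skewness of `J`, the left side stands for `2⟨(∇_X J) Y, Z⟩`. The
identity is formal: once `J` is moved across the inner products, the derivative terms and the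
bracket terms match one by one. -/
theorem koszul_add_koszul
    (hJ2 : ∀ (x : M) (v : TangentSpace 𝓘(ℝ, E) x), J x (J x v) = -v)
    (hJs : ∀ (x : M) (u v : TangentSpace 𝓘(ℝ, E) x), inner ℝ (J x u) v = - inner ℝ u (J x v))
    (x : M) :
    koszul X (fun y ↦ J y (Y y)) Z x + koszul X Y (fun y ↦ J y (Z y)) x =
      extDerivForm J X Y Z x - extDerivForm J X (fun y ↦ J y (Y y)) (fun y ↦ J y (Z y)) x +
        inner ℝ (nijenhuis J Y Z x) (J x (X x)) := by
  simp only [koszul, extDerivForm, nijenhuis, hJs, hJ2, inner_sub_left, inner_neg_left,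
    inner_neg_right, mvfderiv_fun_neg]
  ring

theorem leviCivita_almostComplex [T2Space M] (hJ : IsSmoothEndomorphism J)
    (hJ2 : ∀ (x : M) (v : TangentSpace 𝓘(ℝ, E) x), J x (J x v) = -v)
    (hJs : ∀ (x : M) (u v : TangentSpace 𝓘(ℝ, E) x), inner ℝ (J x u) v = - inner ℝ u (J x v))
    (hN : ∀ Y Z : ∀ x : M, TangentSpace 𝓘(ℝ, E) x, IsSmoothField Y → IsSmoothField Z →
      ∀ x, nijenhuis J Y Z x = 0)
    (hd : ∀ X Y Z : ∀ x : M, TangentSpace 𝓘(ℝ, E) x, IsSmoothField X → IsSmoothField Y →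
      IsSmoothField Z → ∀ x, extDerivForm J X Y Z x = 0)
    (hY : IsSmoothField Y) (x : M) (v : TangentSpace 𝓘(ℝ, E) x) :
    leviCivita (fun y ↦ J y (Y y)) x v = J x (leviCivita Y x v) := by
  obtain ⟨X, hX, rfl⟩ := exists_smoothField v
  refine ext_inner_right ℝ fun z ↦ ?_
  obtain ⟨Z, hZ, rfl⟩ := exists_smoothField z
  have hJY := hJ.isSmoothField hY
  have hJZ := hJ.isSmoothField hZ
  have h := koszul_add_koszul (X := X) (Y := Y) (Z := Z) hJ2 hJs x
  rw [hd X Y Z hX hY hZ, hd X _ _ hX hJY hJZ, hN Y Z hY hZ,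
    ← inner_leviCivita (hX.mdifferentiableAt x) (hJY.mdifferentiableAt x) (hZ.mdifferentiableAt x),
    ← inner_leviCivita (hX.mdifferentiableAt x) (hY.mdifferentiableAt x)
      (hJZ.mdifferentiableAt x), inner_zero_left] at h
  rw [hJs]
  linarith

theorem curvatureEndomorphism_comm [T2Space M] (hJ : IsSmoothEndomorphism J)
    (h : ∀ Y : ∀ x : M, TangentSpace 𝓘(ℝ, E) x, IsSmoothField Y → ∀ (x : M)
      (v : TangentSpace 𝓘(ℝ, E) x), leviCivita (fun y ↦ J y (Y y)) x v = J x (leviCivita Y x v))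
    (hU : IsSmoothField U) (hV : IsSmoothField V) (x : M) (w : TangentSpace 𝓘(ℝ, E) x) :
    curvatureEndomorphism U V x (J x w) = J x (curvatureEndomorphism U V x w) := by
  obtain ⟨W, hW, rfl⟩ := exists_smoothField w
  rw [curvatureEndomorphism_apply hU hV hW]
  refine (curvatureEndomorphism_apply hU hV (hJ.isSmoothField hW) x).trans ?_
  simp only [curvatureOperator, h W hW, h _ (hU.leviCivita hW), h _ (hV.leviCivita hW), map_sub]

theorem inner_curvatureEndomorphism [T2Space M] (hU : IsSmoothField U) (hV : IsSmoothField V)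
    (x : M) (u v : TangentSpace 𝓘(ℝ, E) x) :
    inner ℝ (curvatureEndomorphism U V x u) v = - inner ℝ u (curvatureEndomorphism U V x v) := by
  obtain ⟨W, hW, rfl⟩ := exists_smoothField u
  obtain ⟨Z, hZ, rfl⟩ := exists_smoothField v
  rw [curvatureEndomorphism_apply hU hV hW, curvatureEndomorphism_apply hU hV hZ,
    inner_curvatureOperator hU hV hW hZ]

theorem isSmoothEndomorphism_curvatureEndomorphism [T2Space M] (hU : IsSmoothField U)
    (hV : IsSmoothField V) :
    IsSmoothEndomorphism fun x : M ↦ curvatureEndomorphism U V x := by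
  refine isSmoothEndomorphism_of_field fun W hW ↦ ?_
  simp only [curvatureEndomorphism_apply hU hV hW]
  exact hU.curvatureOperator hV hW

end
end RiemannianGeometry

/-! ### Kähler manifolds -/

namespace KahlerGeometry

open RiemannianGeometry

section

variable {E : Type*} [NormedAddCommGroup E] [NormedSpace ℂ E]
  {X : Type*} [TopologicalSpace X] [ChartedSpace E X]

theorem complexStructure_complexStructure (x : X) (v : TangentSpace 𝓘(ℝ, E) x) :
    complexStructure x (complexStructure x v) = -v := by
  have h (v : E) : Complex.I • Complex.I • v = -v := by
    rw [smul_smul, Complex.I_mul_I, neg_one_smul]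
  exact h v

theorem complexStructure_eq_zero {x : X} {v : TangentSpace 𝓘(ℝ, E) x}
    (h : complexStructure x v = 0) : v = 0 := by
  rw [← neg_eq_zero, ← complexStructure_complexStructure, h, map_zero]

variable [IsManifold 𝓘(ℂ, E) ω X]

/-- The coordinate changes of the tangent bundle of a complex manifold are complex linear. -/
theorem tangentCoordChange_I_smul {x y z : X} (hx : z ∈ (chartAt E x).source)
    (hy : z ∈ (chartAt E y).source) (v : E) :
    tangentCoordChange 𝓘(ℝ, E) x y z (Complex.I • v : E) =
      (Complex.I • (tangentCoordChange 𝓘(ℝ, E) x y z v : E) : E) := by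
  have : IsManifold 𝓘(ℂ, E) 1 X := IsManifold.of_le (n := ω) le_top
  have h₁ := hasFDerivWithinAt_tangentCoordChange (I := 𝓘(ℝ, E)) (x := x) (y := y) (z := z)
    (by simpa only [extChartAt_source] using ⟨hx, hy⟩)
  have h₂ := (hasFDerivWithinAt_tangentCoordChange (I := 𝓘(ℂ, E)) (x := x) (y := y) (z := z)
    (by simpa only [extChartAt_source] using ⟨hx, hy⟩)).restrictScalars ℝ
  -- The real derivative of the holomorphic coordinate change is unique, hence it is the complex
  -- derivative with scalars restricted.
  have e : tangentCoordChange 𝓘(ℝ, E) x y z =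
      (tangentCoordChange 𝓘(ℂ, E) x y z).restrictScalars ℝ :=
    (𝓘(ℝ, E).uniqueDiffOn _ ⟨_, rfl⟩).eq h₁ h₂
  rw [e]
  exact map_smul (tangentCoordChange 𝓘(ℂ, E) x y z) Complex.I v

/-- Holomorphic coordinate changes commute with `i`, so `J` is the same constant map in every chart.
This is the constancy that `nijenhuis_eq_zero` requires, with `J₀` multiplication by `i`. -/
theorem complexStructure_symmL {x y : X} (hy : y ∈ (chartAt E x).source) (v : E) :
    complexStructure y ((trivializationAt E (TangentSpace 𝓘(ℝ, E)) x).symmL ℝ y v) =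
      (trivializationAt E (TangentSpace 𝓘(ℝ, E)) x).symmL ℝ y (Complex.I • v : E) := by
  rw [TangentBundle.symmL_trivializationAt_eq_core hy]
  exact (tangentCoordChange_I_smul hy (mem_chart_source E y) v).symm

theorem isSmoothEndomorphism_complexStructure :
    IsSmoothEndomorphism fun x : X ↦ complexStructure (E := E) x := by
  intro x
  refine (contMDiffAt_const (c := Complex.I • ContinuousLinearMap.id ℝ E)).congr_of_eventuallyEq ?_
  filter_upwards [(chartAt E x).open_source.mem_nhds (mem_chart_source E x)] with y hy
  ext v
  simp only [localEndomorphism, ContinuousLinearMap.comp_apply]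
  rw [complexStructure_symmL hy, Trivialization.continuousLinearMapAt_symmL _ hy]
  rfl

end

section

variable {E : Type*} [NormedAddCommGroup E] [NormedSpace ℂ E] [FiniteDimensional ℂ E]
  {X : Type*} [TopologicalSpace X] [T2Space X] [ChartedSpace E X] [IsManifold 𝓘(ℂ, E) ω X]
  [RiemannianBundle (fun x : X ↦ TangentSpace 𝓘(ℝ, E) x)]
  [IsContMDiffRiemannianBundle 𝓘(ℝ, E) ∞ E (fun x : X ↦ TangentSpace 𝓘(ℝ, E) x)]

omit [FiniteDimensional ℂ E] [T2Space X]
  [IsContMDiffRiemannianBundle 𝓘(ℝ, E) ∞ E (fun x : X ↦ TangentSpace 𝓘(ℝ, E) x)] in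
theorem IsKahler.inner_complexStructure (hX : IsKahler E X) (x : X)
    (u v : TangentSpace 𝓘(ℝ, E) x) :
    inner ℝ (complexStructure x u) v = - inner ℝ u (complexStructure x v) := by
  rw [← hX.hermitian x u, complexStructure_complexStructure, inner_neg_right, neg_neg]

/-- The complex structure of a Kähler manifold is parallel. -/
theorem IsKahler.leviCivita_complexStructure (hX : IsKahler E X)
    {Y : ∀ x : X, TangentSpace 𝓘(ℝ, E) x} (hY : IsSmoothField Y) (x : X)
    (v : TangentSpace 𝓘(ℝ, E) x) :
    leviCivita (fun y ↦ complexStructure y (Y y)) x v = complexStructure x (leviCivita Y x v) :=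
  leviCivita_almostComplex isSmoothEndomorphism_complexStructure complexStructure_complexStructure
    hX.inner_complexStructure
    (fun _ _ hY hZ x ↦ nijenhuis_eq_zero isSmoothEndomorphism_complexStructure
      complexStructure_complexStructure (fun _ hy v ↦ complexStructure_symmL hy v)
      (hY.mdifferentiableAt x) (hZ.mdifferentiableAt x))
    (fun A B C hA hB hC x ↦ hX.closed A B C hA hB hC x) hY x v

/-- `R(U,V)` commutes with the parallel `J` and is skew for the metric; together these give skewness
for `ω`. -/
theorem IsKahler.fundamentalForm_curvatureEndomorphism (hX : IsKahler E X)
    {U V : ∀ x : X, TangentSpace 𝓘(ℝ, E) x} (hU : IsSmoothField U) (hV : IsSmoothField V) (x : X)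
    (u v : TangentSpace 𝓘(ℝ, E) x) :
    inner ℝ (complexStructure x (curvatureEndomorphism U V x u)) v =
      - inner ℝ (complexStructure x u) (curvatureEndomorphism U V x v) := by
  rw [← curvatureEndomorphism_comm isSmoothEndomorphism_complexStructure
    (fun Y hY ↦ hX.leviCivita_complexStructure hY) hU hV, inner_curvatureEndomorphism hU hV]

end

end KahlerGeometry

theorem mainTheorem8 {E : Type*} [NormedAddCommGroup E] [NormedSpace ℂ E] [FiniteDimensional ℂ E]
    {X : Type*} [TopologicalSpace X] [T2Space X] [CompactSpace X]
    [ChartedSpace E X] [IsManifold 𝓘(ℂ, E) ω X]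
    [RiemannianBundle (fun x : X ↦ TangentSpace 𝓘(ℝ, E) x)]
    [IsContMDiffRiemannianBundle 𝓘(ℝ, E) ∞ E (fun x : X ↦ TangentSpace 𝓘(ℝ, E) x)]
    (hX : KahlerGeometry.IsKahler E X)
    (U V : ∀ x : X, TangentSpace 𝓘(ℝ, E) x)
    (hU : RiemannianGeometry.IsSmoothField U) (hV : RiemannianGeometry.IsSmoothField V) :
    -- the endomorphism `R(U,V)` of `TX` acts on smooth fields as the curvature operator
    (∀ W : ∀ x : X, TangentSpace 𝓘(ℝ, E) x, RiemannianGeometry.IsSmoothField W →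
      ∀ x : X, RiemannianGeometry.curvatureEndomorphism U V x (W x) =
        RiemannianGeometry.curvatureOperator U V W x) ∧
    KahlerGeometry.IsSymplecticAutomorphism (fun x : X ↦
      RiemannianGeometry.expEndomorphism (RiemannianGeometry.curvatureEndomorphism U V x)) ∧
    ∃ (N : ℕ) (F : Fin N → ∀ x : X, TangentSpace 𝓘(ℝ, E) x →L[ℝ] TangentSpace 𝓘(ℝ, E) x),
      (∀ j : Fin N, KahlerGeometry.IsSymplecticAutomorphism (F j) ∧
        RiemannianGeometry.IsUnipotentOnFibers (F j)) ∧
      -- `exp (R(U,V)) = F_{N-1} ∘ ⋯ ∘ F_0`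
      ∀ x : X, RiemannianGeometry.expEndomorphism
          (RiemannianGeometry.curvatureEndomorphism U V x) =
        (List.ofFn fun j : Fin N ↦ F j x).reverse.prod := by
  have hJ := KahlerGeometry.isSmoothEndomorphism_complexStructure (E := E) (X := X)
  have hA := RiemannianGeometry.isSmoothEndomorphism_curvatureEndomorphism hU hV
  have hAJ := hX.fundamentalForm_curvatureEndomorphism hU hV
  have := FiniteDimensional.complete ℝ E
  refine ⟨fun W hW x ↦ RiemannianGeometry.curvatureEndomorphism_apply hU hV hW x,
    ⟨RiemannianGeometry.isVectorBundleAutomorphism_exp hA, fun x u v ↦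
      RiemannianGeometry.inner_expEndomorphism hAJ x u v⟩, ?_⟩
  have hmem := RiemannianGeometry.expEndomorphism_mem_closure_unipotentAutomorphisms
    (fun W hW ↦ hJ.isSmoothField hW)
    (fun x u hu ↦ KahlerGeometry.complexStructure_eq_zero hu)
    (fun x u ↦ by
      have := hX.inner_complexStructure x u u
      rw [real_inner_comm] at this
      have h := real_inner_comm (KahlerGeometry.complexStructure x u) u
      linarith) hA hAJ
  obtain ⟨l, hl, hprod⟩ := Submonoid.exists_list_of_mem_closure hmem
  -- The product of `l` has its first entry outermost, while the factors are numbered from the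
  -- innermost one; hence the reversal.
  refine ⟨l.reverse.length, l.reverse.get, fun j ↦ ?_, fun x ↦ ?_⟩
  · exact hl _ (List.mem_reverse.1 (l.reverse.get_mem j))
  · have h₁ : (List.ofFn fun j ↦ l.reverse.get j x) = l.reverse.map fun S ↦ S x := by
      conv_rhs => rw [← List.ofFn_get l.reverse, List.map_ofFn]
      rfl
    rw [h₁, ← List.map_reverse, List.reverse_reverse]
    exact (congrFun hprod.symm x).trans (Pi.list_prod_apply ..)
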